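/- Let $N\in\mathbb N$, let $\alpha_1,\dots,\alpha_N\in(0,1)$, let $\mathbf x_1,\dots,\mathbf x_N\in\mathbb R^2$, and let $r_*>0$ satisfy $r_*<\tfrac12|\mathbf x_m-\mathbf x_n|$ for all $m\ne n$. For $1\le n\le N$ put $\mathbf A_n(\mathbf x)=\alpha_n\,(\mathbf x-\mathbf x_n)^{\perp}/|\mathbf x-\mathbf x_n|^2$ with $(a,b)^\perp=(-b,a)$, and put $\mathbf A_0=0$. Let $\xi_0,\dots,\xi_N:\mathbb R^2\to[0,1]$ be $C^2$ functions with $\sum_{n=0}^N\xi_n^2=1$ and, for $1\le n\le N$, $\operatorname{supp}\xi_n\subset B_{r_*}(\mathbf x_n)$ and $\xi_n=1$ on $B_{r_*/2}(\mathbf x_n)$. For $n\geq 1$ let $\mathbf S_n=\sum_{m\neq n}\mathbf A_m$, $\mathbf a_n=\mathbf S_n(\mathbf x_n)$; let $\mathbf S_0=\sum_{m=1}^N\mathbf A_m$ and fix any $\mathbf x_0,\mathbf a_0\in\mathbb R^2$ (for instance $\mathbf a_0=0$). Put $\check{\mathbf S}_n=\mathbf S_n-\mathbf a_n$ and $\theta_n(\mathbf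 x)=\mathbf a_n\cdot(\mathbf x-\mathbf x_n)$ for $0\le n\le N$. Let $H_N^{(\mathrm F)}$ be the Friedrichs realization in $L^2(\mathbb R^2)$ of $\big(-i\nabla+\sum_{m=1}^N\mathbf A_m\big)^2$, that is, the operator associated with the closure of the quadratic form $\|(-i\nabla+\sum_m\mathbf A_m)\psi\|_2^2$ on $C^\infty_c(\mathbb R^2\setminus\{\mathbf x_1,\dots,\mathbf x_N\})$. Likewise let $H_n^{(\mathrm F)}$ be the Friedrichs realization of $(-i\nabla+\mathbf A_n)^2$, starting from $C^\infty_c(\mathbb R^2\setminus\{\mathbf x_n\})$, for $1\le n\le N$, and let $H_0^{(\mathrm F)}=-\Delta$ be the free Laplacian. Let $R_N^{(\mathrm F)}(z)=(H_N^{(\mathrm F)}-z)^{-1}$ denote the resolvent of the $N$-flux operator and $R_n^{(\mathrm F)}(z)=(H_n^{(\mathrm F)}-z)^{-1}$, $0\le n\le N$, those of the single-flux operators and of $-\Delta$ (so the label $N$ in the summand $n=N$ below refers to the single flux $\mathbf x_N$, not to the $N$-flux operator). Define $$P_n=2\big(\check{\mathbf S}_n\xi_n-i\nabla\xi_n\big)\cdot(-i\nabla+\mathbf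 A_n)+\check{\mathbf S}_n^2\,\xi_n+2\,\check{\mathbf S}_n\cdot(-i\nabla\xi_n)-\Delta\xi_n ,$$ $$T_N(z)=\sum_{n=0}^N e^{-i\theta_n}\,P_n\,R_n^{(\mathrm F)}(z)\,\xi_n\,e^{i\theta_n}.$$ Then every $z\in\mathbb C\setminus[0,+\infty)$ belongs to the resolvent sets of $H_N^{(\mathrm F)}$ and of all the $H_n^{(\mathrm F)}$; for every such $z$ the operator $T_N(z)$ is defined and bounded on $L^2(\mathbb R^2)$, the operator $1+T_N(z)$ has a bounded inverse, and $$R_N^{(\mathrm F)}(z)=\sum_{n=0}^N e^{-i\theta_n}\,\xi_n\,R_n^{(\mathrm F)}(z)\,\xi_n\,e^{i\theta_n}\,\big[1+T_N(z)\big]^{-1}.$$ Moreover there is $\delta>0$ such that, for all $z\in\mathbb C\setminus[0,+\infty)$ with $d:=\operatorname{dist}(z,[0,+\infty))$ and $\frac1d\big(1+\frac{|z|}{d}\big)\le\delta$, one has $\|T_N(z)\|<1$ and $[1+T_N(z)]^{-1}=\sum_{j\ge0}(-1)^jT_N(z)^j$ in operator norm. -/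

import Mathlib

open MeasureTheory Complex
open scoped ContDiff

noncomputable section

namespace AharonovBohm

/-- The Euclidean plane. -/
abbrev E2 := EuclideanSpace ℝ (Fin 2)

/-- The Hilbert space of complex square-integrable functions on the plane. -/
abbrev L2 := Lp ℂ 2 (volume : Measure E2)

/-- The Hilbert space of square-integrable complex vector fields on the plane. -/
abbrev L2V := Lp (EuclideanSpace ℂ (Fin 2)) 2 (volume : Measure E2)

/-- Rotation by a right angle, `(a, b) ↦ (-b, a)`. -/
def perp (v : E2) : E2 := !₂[-(v 1), v 0]

variable {N : ℕ}

/-- The vector potential `∑ n ∈ s, α n (y - x n)^⊥ / |y - x n|²` of the fluxes with label in `s`. -/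
def potential (α : Fin N → ℝ) (x : Fin N → E2) (s : Finset (Fin N)) (y : E2) : E2 :=
  ∑ n ∈ s, (α n / ‖y - x n‖ ^ 2) • perp (y - x n)

/-- The partial derivative of a complex function in the `j`-th coordinate direction. -/
def partialDeriv (j : Fin 2) (φ : E2 → ℂ) (y : E2) : ℂ :=
  fderiv ℝ φ y (EuclideanSpace.single j 1)

/-- The magnetic gradient `(-i∇ + A) φ`. -/
def magGrad (A : E2 → E2) (φ : E2 → ℂ) (y : E2) : EuclideanSpace ℂ (Fin 2) :=
  WithLp.toLp 2 fun j => -I * partialDeriv j φ y + ((A y j : ℝ) : ℂ) * φ y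

/-- Smooth compactly supported functions whose support avoids the fluxes with label in `s`. -/
def IsTestFunction (x : Fin N → E2) (s : Finset (Fin N)) (φ : E2 → ℂ) : Prop :=
  ContDiff ℝ ∞ φ ∧ HasCompactSupport φ ∧ ∀ n ∈ s, x n ∉ tsupport φ

theorem isTestFunction_zero (x : Fin N → E2) (s : Finset (Fin N)) :
    IsTestFunction x s (0 : E2 → ℂ) :=
  ⟨contDiff_const, HasCompactSupport.zero, fun n _ => by simp [tsupport]⟩

theorem IsTestFunction.add {x : Fin N → E2} {s : Finset (Fin N)} {φ ψ : E2 → ℂ}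
    (hφ : IsTestFunction x s φ) (hψ : IsTestFunction x s ψ) : IsTestFunction x s (φ + ψ) :=
  ⟨hφ.1.add hψ.1, hφ.2.1.add hψ.2.1, fun n hn h =>
    (tsupport_add φ ψ h).elim (hφ.2.2 n hn) (hψ.2.2 n hn)⟩

theorem IsTestFunction.smul {x : Fin N → E2} {s : Finset (Fin N)} {φ : E2 → ℂ}
    (c : ℂ) (hφ : IsTestFunction x s φ) : IsTestFunction x s (c • φ) :=
  ⟨contDiff_const.smul hφ.1, hφ.2.1.smul_left (f := fun _ => c), fun n hn h =>
    hφ.2.2 n hn (tsupport_smul_subset_right (fun _ => c) φ h)⟩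

theorem magGrad_zero (A : E2 → E2) : magGrad A (0 : E2 → ℂ) = 0 := by
  funext y
  ext j
  simp [magGrad, partialDeriv]

theorem magGrad_add (A : E2 → E2) {φ ψ : E2 → ℂ} (hφ : Differentiable ℝ φ)
    (hψ : Differentiable ℝ ψ) : magGrad A (φ + ψ) = magGrad A φ + magGrad A ψ := by
  funext y
  ext j
  simp only [magGrad, partialDeriv, fderiv_add (hφ y) (hψ y), Pi.add_apply, PiLp.add_apply,
    _root_.add_apply]
  ring

theorem magGrad_smul (A : E2 → E2) (c : ℂ) {φ : E2 → ℂ} (hφ : Differentiable ℝ φ) :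
    magGrad A (c • φ) = c • magGrad A φ := by
  funext y
  ext j
  simp only [magGrad, partialDeriv, fderiv_const_smul (hφ y) c, Pi.smul_apply, PiLp.smul_apply,
    _root_.smul_apply, smul_eq_mul]
  ring

/-- The graph in `L² × L²(ℂ²)` of the magnetic gradient of the potential of the fluxes in `s`,
acting on smooth compactly supported functions with support away from these fluxes. -/
def minGraph (α : Fin N → ℝ) (x : Fin N → E2) (s : Finset (Fin N)) : Submodule ℂ (L2 × L2V) where
  carrier := {p | ∃ φ : E2 → ℂ, IsTestFunction x s φ ∧ p.1 =ᵐ[volume] φ ∧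
    p.2 =ᵐ[volume] magGrad (potential α x s) φ}
  zero_mem' := ⟨0, isTestFunction_zero x s, Lp.coeFn_zero _ _ _, by
    rw [magGrad_zero]
    exact Lp.coeFn_zero _ _ _⟩
  add_mem' := by
    rintro p q ⟨φ, hφ, h1, h2⟩ ⟨ψ, hψ, k1, k2⟩
    refine ⟨φ + ψ, hφ.add hψ, (Lp.coeFn_add p.1 q.1).trans (h1.add k1), ?_⟩
    rw [magGrad_add _ (hφ.1.differentiable (by simp)) (hψ.1.differentiable (by simp))]
    exact (Lp.coeFn_add p.2 q.2).trans (h2.add k2)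
  smul_mem' := by
    rintro c p ⟨φ, hφ, h1, h2⟩
    refine ⟨c • φ, hφ.smul c, (Lp.coeFn_smul c p.1).trans (h1.const_smul c), ?_⟩
    rw [magGrad_smul _ c (hφ.1.differentiable (by simp))]
    exact (Lp.coeFn_smul c p.2).trans (h2.const_smul c)

/-- The closed magnetic gradient of the fluxes in `s`. Its domain is the completion of the test
functions in the norm `(‖ψ‖² + ‖(-i∇ + A) ψ‖²)^(1/2)`, that is, the Friedrichs form domain. -/
def formGrad (α : Fin N → ℝ) (x : Fin N → E2) (s : Finset (Fin N)) : L2 →ₗ.[ℂ] L2V :=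
  (minGraph α x s).topologicalClosure.toLinearPMap

/-- The sesquilinear Friedrichs form `Q[v, u] = ⟪(-i∇ + A) v, (-i∇ + A) u⟫`. -/
def friedrichsForm (α : Fin N → ℝ) (x : Fin N → E2) (s : Finset (Fin N))
    (v u : (formGrad α x s).domain) : ℂ :=
  inner ℂ (formGrad α x s v) (formGrad α x s u)

/-- The graph of the operator associated with the Friedrichs form: all `(u, w)` such that `u` is
in the form domain and `Q[v, u] = ⟪v, w⟫` for all `v` in the form domain. -/
def friedrichsGraph (α : Fin N → ℝ) (x : Fin N → E2) (s : Finset (Fin N)) :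
    Submodule ℂ (L2 × L2) where
  carrier := {p | ∃ u : (formGrad α x s).domain, (u : L2) = p.1 ∧
    ∀ v : (formGrad α x s).domain, friedrichsForm α x s v u = inner ℂ (v : L2) p.2}
  zero_mem' := ⟨0, rfl, fun v => by simp [friedrichsForm]⟩
  add_mem' := by
    rintro p q ⟨u, hu, h⟩ ⟨w, hw, k⟩
    refine ⟨u + w, by simp [hu, hw], fun v => ?_⟩
    have h' := h v
    have k' := k v
    simp only [friedrichsForm] at h' k' ⊢
    rw [LinearPMap.map_add, inner_add_right, h', k', Prod.snd_add, inner_add_right]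
  smul_mem' := by
    rintro c p ⟨u, hu, h⟩
    refine ⟨c • u, by simp [hu], fun v => ?_⟩
    have h' := h v
    simp only [friedrichsForm] at h' ⊢
    rw [LinearPMap.map_smul, inner_smul_right, h', Prod.smul_snd, inner_smul_right]

/-- The Friedrichs realization of `(-i∇ + A)²`, with `A` the potential of the fluxes in `s`. For
`s = ∅` it is the free Laplacian `-Δ`. -/
def friedrichs (α : Fin N → ℝ) (x : Fin N → E2) (s : Finset (Fin N)) : L2 →ₗ.[ℂ] L2 :=
  (friedrichsGraph α x s).toLinearPMap

/-- `R` is a bounded two-sided inverse of `H - z`. -/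
def IsResolvent (H : L2 →ₗ.[ℂ] L2) (z : ℂ) (R : L2 →L[ℂ] L2) : Prop :=
  (∀ f : L2, ∃ h : R f ∈ H.domain, H ⟨R f, h⟩ - z • R f = f) ∧
    ∀ u : H.domain, R (H u - z • (u : L2)) = u

/-- `z` belongs to the resolvent set of `H`. -/
def InResolventSet (H : L2 →ₗ.[ℂ] L2) (z : ℂ) : Prop := ∃ R, IsResolvent H z R

open Classical in
/-- The resolvent `(H - z)⁻¹`, for `z` in the resolvent set of `H` (and zero otherwise). -/
def resolventOp (H : L2 →ₗ.[ℂ] L2) (z : ℂ) : L2 →L[ℂ] L2 :=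
  if h : InResolventSet H z then h.choose else 0

open Classical in
/-- Multiplication of `f` by the function `g` (zero if the product is not in `L²`, which does not
happen for bounded measurable `g`). -/
def mulL2 (g : E2 → ℂ) (f : L2) : L2 :=
  if h : MemLp (fun y => g y * f y) 2 (volume : Measure E2) then h.toLp _ else 0

/-- `none` stands for the index `0` and `some n` for the flux with label `n`. A partition of unity
adapted to the fluxes: `C²` functions with values in `[0, 1]`, the function of the flux `n`
supported in the open disc of radius `r` about `x n` and equal to `1` on the disc of half the
radius, with squares that sum to `1`. -/
structure IsFluxPartition (x : Fin N → E2) (r : ℝ) (ξ : Option (Fin N) → E2 → ℝ) : Prop where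
  contDiff : ∀ n, ContDiff ℝ 2 (ξ n)
  mem_Icc : ∀ n y, ξ n y ∈ Set.Icc (0 : ℝ) 1
  tsupport_subset : ∀ n : Fin N, tsupport (ξ (some n)) ⊆ Metric.ball (x n) r
  eq_one : ∀ n : Fin N, ∀ y ∈ Metric.ball (x n) (r / 2), ξ (some n) y = 1
  sum_sq : ∀ y, ∑ n, ξ n y ^ 2 = 1

/-- The regular part `S n = ∑ m ≠ n, A m` of the potential near the flux `n`; for `n = none` it is
the full potential. -/
def regPart (α : Fin N → ℝ) (x : Fin N → E2) (n : Option (Fin N)) : E2 → E2 :=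
  potential α x (n.toFinset)ᶜ

/-- The points `x n`, with `x₀` for the index `none`. -/
def basePoint (x : Fin N → E2) (x₀ : E2) : Option (Fin N) → E2
  | none => x₀
  | some n => x n

/-- The constant vectors `S n (x n)`, with `a₀` for the index `none`. -/
def gaugeVec (α : Fin N → ℝ) (x : Fin N → E2) (a₀ : E2) : Option (Fin N) → E2
  | none => a₀
  | some n => regPart α x (some n) (x n)

/-- The gauge phase `exp (i S n (x n) · (y - x n))`. -/
def phase (α : Fin N → ℝ) (x : Fin N → E2) (x₀ a₀ : E2) (n : Option (Fin N)) (y : E2) : ℂ :=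
  cexp (I * ((inner ℝ (gaugeVec α x a₀ n) (y - basePoint x x₀ n) : ℝ) : ℂ))

/-- `Š n (y) = S n (y) - S n (x n)`. -/
def regPartSub (α : Fin N → ℝ) (x : Fin N → E2) (a₀ : E2) (n : Option (Fin N)) (y : E2) : E2 :=
  regPart α x n y - gaugeVec α x a₀ n

open Classical in
/-- `(-i∇ + A n) u` for `u` in the Friedrichs form domain of the single flux `n` (of the free
Laplacian, for `n = none`); zero for other `u`. -/
def singleGrad (α : Fin N → ℝ) (x : Fin N → E2) (n : Option (Fin N)) (u : L2) : L2V :=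
  if h : u ∈ (formGrad α x n.toFinset).domain then formGrad α x n.toFinset ⟨u, h⟩ else 0

/-- The first-order operator
`P n = 2 (Š n ξ n - i∇ξ n) · (-i∇ + A n) + |Š n|² ξ n + 2 Š n · (-i∇ξ n) - Δ ξ n`
applied to `u`. -/
def localOp (α : Fin N → ℝ) (x : Fin N → E2) (a₀ : E2) (ξ : Option (Fin N) → E2 → ℝ)
    (n : Option (Fin N)) (u : L2) (y : E2) : ℂ :=
  2 * ∑ j : Fin 2, (((regPartSub α x a₀ n y j * ξ n y : ℝ) : ℂ) - I * (gradient (ξ n) y j : ℝ))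
      * singleGrad α x n u y j
    + (((‖regPartSub α x a₀ n y‖ ^ 2 * ξ n y : ℝ) : ℂ)
      + 2 * ∑ j : Fin 2, (regPartSub α x a₀ n y j : ℂ) * (-I * (gradient (ξ n) y j : ℝ))
      - (Laplacian.laplacian (ξ n) y : ℝ)) * u y

/-- The resolvent at `z` of the Friedrichs Hamiltonian of the single flux `n`; for `n = none` it is
the free resolvent `(-Δ - z)⁻¹`. -/
def singleResolvent (α : Fin N → ℝ) (x : Fin N → E2) (n : Option (Fin N)) (z : ℂ) : L2 →L[ℂ] L2 :=
  resolventOp (friedrichs α x n.toFinset) z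

/-- The function `∑ n, e^{-iθ n} P n R n (z) (ξ n e^{iθ n} f)`, with `e^{iθ n}` the gauge phase. -/
def TFun (α : Fin N → ℝ) (x : Fin N → E2) (x₀ a₀ : E2) (ξ : Option (Fin N) → E2 → ℝ) (z : ℂ)
    (f : L2) (y : E2) : ℂ :=
  ∑ n, (phase α x x₀ a₀ n y)⁻¹ * localOp α x a₀ ξ n
    (singleResolvent α x n z (mulL2 (fun y' => (ξ n y' : ℂ) * phase α x x₀ a₀ n y') f)) y

/-- The vector `∑ n, e^{-iθ n} ξ n R n (z) (ξ n e^{iθ n} f)`, with `e^{iθ n}` the gauge phase. -/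
def localizedSum (α : Fin N → ℝ) (x : Fin N → E2) (x₀ a₀ : E2) (ξ : Option (Fin N) → E2 → ℝ)
    (z : ℂ) (f : L2) : L2 :=
  ∑ n, mulL2 (fun y => (phase α x x₀ a₀ n y)⁻¹ * (ξ n y : ℂ))
    (singleResolvent α x n z (mulL2 (fun y => (ξ n y : ℂ) * phase α x x₀ a₀ n y) f))

/-- The half-line `[0, ∞)` in the complex plane. -/
def halfLine : Set ℂ := Complex.ofReal '' Set.Ici (0 : ℝ)

end AharonovBohm

end

/-! Everything is done with forms. Let `V` be the form domain of the `N`-flux operator with its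
graph norm, `e : V → L²` the inclusion, and `A` the operator on `V` representing `⟪Dv, Du⟫ - z⟪v,
u⟫`; let `B n` be its analogue on the form domain of the flux `n`. For `z` off `[0, ∞)` some complex
`τ` rotates all these forms into coercive ones with a common constant, so `A` and `B n` are
invertible and the resolvents are `e A⁻¹ e*` and `e n (B n)⁻¹ (e n)*`.

Put `g n = e^{-iθ n} ξ n`. Multiplication by `g n` and by its conjugate gives maps `K n` into `V`
and `M n` out of `V`, with `∑ K n M n = 1` because `∑ |g n|² = 1`. Integration by parts yields `A K
n = (M n)* B n + e* p n` with `p n = e^{-iθ n} P n` of first order. For `J = ∑ K n (B n)⁻¹ (K n)*`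
and `t = ∑ p n (B n)⁻¹ (K n)*` this sums to `A J = 1 + e* t`, while `T = t e*`. Hence `A⁻¹ e* (1 +
T) = J e*`, which is the resolvent formula.

Invertibility of `1 + T` at every `z`, not only where the Neumann series converges, comes from `J`:
each `(B n)⁻¹` is coercive for the conjugate of `τ`, and the partition of unity passes this on to
`J`. So `A J = 1 + e* t` is invertible, and therefore so is `1 + t e*`. The carrying lemmas are
`localization_formula` (abstract algebra), `IsFluxCutoff.comp_eq` (commutator identity), and
`magGrad_cutoff`, `magLaplacian_cutoff` (identification with `P n`). The norm bound on `T` comes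
from testing the resolvent equation with its own solution. -/

open MeasureTheory Complex
open scoped ContDiff

noncomputable section

namespace AharonovBohm

/-! ### Coercive operators and the abstract localization formula. -/

section

section Hilbert

open ContinuousLinearMap

/-- For `z` off the half-line `[0, ∞)` both `1` and `-z` lie in a common open half-plane through
the origin. -/
theorem exists_rotation_pos {z : ℂ} (hz : z ∉ halfLine) : ∃ τ : ℂ, 0 < τ.re ∧ 0 < (-(τ * z)).re :=
    by
  rcases eq_or_ne z.im 0 with h | h
  · refine ⟨1, by simp, ?_⟩
    have : z.re < 0 := by
      by_contra! h'
      exact hz ⟨z.re, h', Complex.ext (by simp) (by simp [h])⟩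
    simpa using this
  -- The imaginary part is chosen so that `τ * z` has real part `-1`.
  · refine ⟨⟨1, (z.re + 1) / z.im⟩, by simp, ?_⟩
    simp only [neg_re, mul_re]
    field_simp
    norm_num

/-- If `1 + b a` is invertible then so is `1 + a b`. -/
theorem isUnit_one_add_comp_swap {V H : Type*} [NormedAddCommGroup V] [NormedSpace ℂ V]
    [NormedAddCommGroup H] [NormedSpace ℂ H] {a : V →L[ℂ] H} {b : H →L[ℂ] V}
    (h : IsUnit (1 + b ∘L a)) : IsUnit (1 + a ∘L b) := by
  obtain ⟨s, hus, hsu⟩ := isUnit_iff_exists.1 h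
  have h1 : ∀ v, s v + b (a (s v)) = v := fun v => congr($hus v)
  have h2 : ∀ v, s (v + b (a v)) = v := fun v => congr($hsu v)
  -- The formal geometric series suggests `(1 + ab)⁻¹ = 1 - a (1 + ba)⁻¹ b`.
  refine isUnit_iff_exists.2 ⟨1 - a ∘L s ∘L b, ?_, ?_⟩ <;> ext f <;>
    simp only [mul_apply_eq_comp, _root_.add_apply, _root_.sub_apply,
      one_apply_eq_self, ContinuousLinearMap.comp_apply]
  · have h3 := congr(a $(h1 (b f)))
    simp only [map_sub, map_add] at h3 ⊢
    rw [← h3]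
    abel
  · have h3 := congr(a $(h2 (b f)))
    simp only [map_add] at h3 ⊢
    rw [h3]
    abel

variable {V H : Type*} [NormedAddCommGroup V] [InnerProductSpace ℂ V] [CompleteSpace V]
  [NormedAddCommGroup H] [InnerProductSpace ℂ H] [CompleteSpace H]

/-- An operator whose numerical range lies in a half-plane at positive distance from the origin
is invertible. -/
theorem isUnit_of_re_mul_inner_ge {A : V →L[ℂ] V} {τ : ℂ} {c : ℝ} (hc : 0 < c)
    (h : ∀ v, c * ‖v‖ ^ 2 ≤ (τ * inner ℂ v (A v)).re) : IsUnit A := by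
  have hτ : ∀ v : V, c * ‖v‖ ^ 2 ≤ ‖τ‖ * ‖inner ℂ (A v) v‖ := fun v => by
    rw [norm_inner_symm, ← norm_mul]
    exact (h v).trans (re_le_norm _)
  -- This is Lax–Milgram; the `+ 1` avoids having to show `τ ≠ 0`.
  refine isUnit_of_forall_le_norm_inner_map A (c := NNReal.mk (c / (‖τ‖ + 1)) (by positivity))
    (by rw [← NNReal.coe_pos]; exact div_pos hc (by positivity)) fun v => ?_
  have := hτ v
  change ‖v‖ ^ 2 * (c / (‖τ‖ + 1)) ≤ _
  rw [← mul_div_assoc, div_le_iff₀ (by positivity)]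
  nlinarith [norm_nonneg (inner ℂ (A v) v), norm_nonneg τ]

variable {ι : Type*} [Fintype ι] {W : ι → Type*} [∀ i, NormedAddCommGroup (W i)]
  [∀ i, InnerProductSpace ℂ (W i)] [∀ i, CompleteSpace (W i)]

/-- If `B` is coercive with respect to `τ`, then so is a conjugate of its inverse. -/
theorem re_conj_mul_inner_inverse_ge {B : V →L[ℂ] V} {τ : ℂ} {c : ℝ} (hc : 0 < c)
    (h : ∀ v, c * ‖v‖ ^ 2 ≤ (τ * inner ℂ v (B v)).re) (v : V) :
    c * ‖Ring.inverse B v‖ ^ 2 ≤ (starRingEnd ℂ τ * inner ℂ v (Ring.inverse B v)).re := by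
  have h1 : B (Ring.inverse B v) = v :=
    congr($(Ring.mul_inverse_cancel B (isUnit_of_re_mul_inner_ge hc h)) v)
  -- With `v = B w`, the quantity `⟪v, B⁻¹ v⟫ = ⟪B w, w⟫` is the conjugate of `⟪w, B w⟫`.
  have h2 := h (Ring.inverse B v)
  rw [h1, ← inner_conj_symm] at h2
  rw [← conj_re, map_mul, conj_conj]
  exact h2

theorem sum_adjoint_comp_adjoint {K : ∀ i, W i →L[ℂ] V} {M : ∀ i, V →L[ℂ] W i}
    (hKM : ∑ i, K i ∘L M i = 1) : ∑ i, adjoint (M i) ∘L adjoint (K i) = 1 := by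
  have h := congr(adjoint $hKM)
  rw [map_sum, one_def, adjoint_id] at h
  simpa only [adjoint_comp, one_def] using h

/-- The sum of the local inverses is coercive. -/
theorem isUnit_sum_local_inverse {B : ∀ i, W i →L[ℂ] W i} {K : ∀ i, W i →L[ℂ] V}
    {M : ∀ i, V →L[ℂ] W i} {τ : ℂ} {c : ℝ} (hc : 0 < c)
    (hB : ∀ i v, c * ‖v‖ ^ 2 ≤ (τ * inner ℂ v (B i v)).re) (hKM : ∑ i, K i ∘L M i = 1) :
    IsUnit (∑ i, K i ∘L Ring.inverse (B i) ∘L adjoint (K i)) := by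
  set C : ℝ := ∑ i, ‖adjoint (M i)‖ ^ 2 * ‖B i‖ ^ 2
  have hC : 0 ≤ C := by positivity
  refine isUnit_of_re_mul_inner_ge (τ := starRingEnd ℂ τ) (c := c / (C + 1)) (by positivity)
    fun v => ?_
  set w : ∀ i, W i := fun i => Ring.inverse (B i) (adjoint (K i) v)
  have hw : ∀ i, B i (w i) = adjoint (K i) v := fun i =>
    congr($(Ring.mul_inverse_cancel (B i) (isUnit_of_re_mul_inner_ge hc (hB i))) _)
  -- The adjoint partition of unity recovers `v` from the local solutions `w i`, so these cannot all
  -- be small. The diagonal estimate `h2` only controls `∑ ‖w i‖²`.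
  have hv : v = ∑ i, adjoint (M i) (B i (w i)) := by
    simp only [hw]
    simpa using congr($(sum_adjoint_comp_adjoint hKM) v).symm
  have h1 : ‖v‖ ^ 2 ≤ C * ∑ i, ‖w i‖ ^ 2 := by
    calc ‖v‖ ^ 2 ≤ (∑ i, (‖adjoint (M i)‖ * ‖B i‖) * ‖w i‖) ^ 2 := by
          gcongr
          conv_lhs => rw [hv]
          refine (norm_sum_le _ _).trans (Finset.sum_le_sum fun i _ => ?_)
          rw [mul_assoc]
          exact (le_opNorm _ _).trans (by gcongr; exact le_opNorm _ _)
      _ ≤ (∑ i, (‖adjoint (M i)‖ * ‖B i‖) ^ 2) * ∑ i, ‖w i‖ ^ 2 :=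
          Finset.sum_mul_sq_le_sq_mul_sq _ _ _
      _ = _ := by simp only [mul_pow, C]
  have h2 : c * ∑ i, ‖w i‖ ^ 2 ≤ (starRingEnd ℂ τ * inner ℂ v
      ((∑ i, K i ∘L Ring.inverse (B i) ∘L adjoint (K i)) v)).re := by
    rw [_root_.sum_apply, inner_sum, Finset.mul_sum, Finset.mul_sum, re_sum]
    refine Finset.sum_le_sum fun i _ => ?_
    refine (re_conj_mul_inner_inverse_ge hc (hB i) (adjoint (K i) v)).trans_eq ?_
    rw [adjoint_inner_left]
    rfl
  refine le_trans ?_ h2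
  rw [div_mul_eq_mul_div, div_le_iff₀ (by positivity), mul_assoc]
  gcongr
  have : 0 ≤ ∑ i, ‖w i‖ ^ 2 := by positivity
  nlinarith

/-- The abstract localization formula for resolvents. The operators `A` and `B i` represent shifted
coercive forms on the form spaces `V` and `W i`, and `p i` is the commutator of `K i` with the
forms. -/
theorem localization_formula {A : V →L[ℂ] V} {B : ∀ i, W i →L[ℂ] W i} {K : ∀ i, W i →L[ℂ] V}
    {M : ∀ i, V →L[ℂ] W i} {p : ∀ i, W i →L[ℂ] H} {e : V →L[ℂ] H} {τ : ℂ} {c : ℝ} (hc : 0 < c)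
    (hA : ∀ v, c * ‖v‖ ^ 2 ≤ (τ * inner ℂ v (A v)).re)
    (hB : ∀ i v, c * ‖v‖ ^ 2 ≤ (τ * inner ℂ v (B i v)).re) (hKM : ∑ i, K i ∘L M i = 1)
    (hcomm : ∀ i, A ∘L K i = adjoint (M i) ∘L B i + adjoint e ∘L p i) :
    IsUnit (1 + (∑ i, p i ∘L Ring.inverse (B i) ∘L adjoint (K i)) ∘L adjoint e) ∧
    Ring.inverse A ∘L adjoint e ∘L
        (1 + (∑ i, p i ∘L Ring.inverse (B i) ∘L adjoint (K i)) ∘L adjoint e) =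
      (∑ i, K i ∘L Ring.inverse (B i) ∘L adjoint (K i)) ∘L adjoint e := by
  set t : V →L[ℂ] H := ∑ i, p i ∘L Ring.inverse (B i) ∘L adjoint (K i)
  set J : V →L[ℂ] V := ∑ i, K i ∘L Ring.inverse (B i) ∘L adjoint (K i) with hJ
  have hAu := isUnit_of_re_mul_inner_ge hc hA
  -- The commutator identity is applied to `(B i)⁻¹ (K i)* v`: its first terms add up to the adjoint
  -- partition of unity, its second terms to `e* t v`.
  have key : A ∘L J = 1 + adjoint e ∘L t := by
    rw [← sum_adjoint_comp_adjoint hKM, hJ]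
    ext v
    simp only [ContinuousLinearMap.comp_apply, _root_.sum_apply, _root_.add_apply,
      map_sum, t, ← Finset.sum_add_distrib]
    refine Finset.sum_congr rfl fun i _ => ?_
    have h1 := congr($(hcomm i) (Ring.inverse (B i) (adjoint (K i) v)))
    have h2 : B i (Ring.inverse (B i) (adjoint (K i) v)) = adjoint (K i) v :=
      congr($(Ring.mul_inverse_cancel (B i) (isUnit_of_re_mul_inner_ge hc (hB i))) _)
    simpa [h2] using h1
  refine ⟨isUnit_one_add_comp_swap ?_, ?_⟩
  · rw [← key]
    exact hAu.mul (isUnit_sum_local_inverse hc hB hKM)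
  · ext f
    have h1 : J (adjoint e f) = Ring.inverse A (A (J (adjoint e f))) :=
      (congr($(Ring.inverse_mul_cancel A hAu) (J (adjoint e f)))).symm
    have h2 := congr($key (adjoint e f))
    simp only [ContinuousLinearMap.comp_apply, _root_.add_apply, one_apply_eq_self]
      at h2 ⊢
    rw [h1, h2, map_add (adjoint e)]

end Hilbert

end

/-! ### Multiplication operators on `L²` and calculus for the potential. -/

section

section Multiplication

variable {E F : Type*} [NormedAddCommGroup E] [InnerProductSpace ℂ E] [NormedAddCommGroup F]
  [InnerProductSpace ℂ F]

/-- A bounded continuous field of operators. -/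
def IsBddField (B : E2 → E →L[ℂ] F) : Prop := Continuous B ∧ ∃ C, ∀ y, ‖B y‖ ≤ C

theorem IsBddField.memLp {B : E2 → E →L[ℂ] F} (hB : IsBddField B) :
    MemLp B ⊤ (volume : Measure E2) :=
  memLp_top_of_bound hB.1.aestronglyMeasurable hB.2.choose (ae_of_all _ hB.2.choose_spec)

/-- The operator on `L²` of pointwise application of a bounded continuous field of operators. -/
def fieldOp (B : E2 → E →L[ℂ] F) (hB : IsBddField B) :
    Lp E 2 (volume : Measure E2) →L[ℂ] Lp F 2 (volume : Measure E2) :=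
  (ContinuousLinearMap.id ℂ (E →L[ℂ] F)).holderL volume ⊤ 2 2 (hB.memLp.toLp B)

theorem coeFn_fieldOp {B : E2 → E →L[ℂ] F} (hB : IsBddField B) (f : Lp E 2 (volume : Measure E2)) :
    fieldOp B hB f =ᵐ[volume] fun y => B y (f y) := by
  refine ((ContinuousLinearMap.id ℂ (E →L[ℂ] F)).coeFn_holder _ _).trans ?_
  filter_upwards [hB.memLp.coeFn_toLp] with y hy
  simp [hy]

theorem inner_fieldOp_eq {B : E2 → E →L[ℂ] F} (hB : IsBddField B) {B' : E2 → F →L[ℂ] E}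
    (hB' : IsBddField B') (h : ∀ y a b, inner ℂ (B y a) b = inner ℂ a (B' y b))
    (f : Lp E 2 (volume : Measure E2)) (g : Lp F 2 (volume : Measure E2)) :
    inner ℂ (fieldOp B hB f) g = inner ℂ f (fieldOp B' hB' g) := by
  rw [L2.inner_def, L2.inner_def]
  refine integral_congr_ae ?_
  filter_upwards [coeFn_fieldOp hB f, coeFn_fieldOp hB' g] with y h1 h2
  rw [h1, h2, h]

/-- The field of multiplication operators by a function. -/
def scalarField (E : Type*) [NormedAddCommGroup E] [InnerProductSpace ℂ E] (g : E2 → ℂ) (y : E2) :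
    E →L[ℂ] E :=
  g y • ContinuousLinearMap.id ℂ E

theorem isBddField_scalarField {g : E2 → ℂ} (hg : Continuous g) {C : ℝ} (hC : ∀ y, ‖g y‖ ≤ C) :
    IsBddField (scalarField E g) := by
  refine ⟨by unfold scalarField; fun_prop, C, fun y => ?_⟩
  rw [scalarField, norm_smul]
  exact (mul_le_of_le_one_right (norm_nonneg _) ContinuousLinearMap.norm_id_le).trans (hC y)

/-- The field of operators `a ↦ a β(y)`. -/
def vectorField (β : E2 → EuclideanSpace ℂ (Fin 2)) (y : E2) : ℂ →L[ℂ] EuclideanSpace ℂ (Fin 2) :=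
  ContinuousLinearMap.toSpanSingleton ℂ (β y)

theorem isBddField_vectorField {β : E2 → EuclideanSpace ℂ (Fin 2)} (hβ : Continuous β) {C : ℝ}
    (hC : ∀ y, ‖β y‖ ≤ C) : IsBddField (vectorField β) := by
  refine ⟨(ContinuousLinearMap.toSpanSingletonCLE (𝕜 := ℂ)).continuous.comp hβ, C, fun y => ?_⟩
  rw [vectorField, ContinuousLinearMap.norm_toSpanSingleton]
  exact hC y

/-- The field of functionals `w ↦ β(y) · w`, without complex conjugation. -/
def dotField (β : E2 → EuclideanSpace ℂ (Fin 2)) (y : E2) : EuclideanSpace ℂ (Fin 2) →L[ℂ] ℂ :=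
  ∑ j, β y j • EuclideanSpace.proj j

theorem dotField_apply (β : E2 → EuclideanSpace ℂ (Fin 2)) (y : E2) (w : EuclideanSpace ℂ (Fin 2)) :
    dotField β y w = ∑ j, β y j * w j := by
  simp [dotField]

theorem isBddField_dotField {β : E2 → EuclideanSpace ℂ (Fin 2)} (hβ : Continuous β) {C : ℝ}
    (hC : ∀ y, ‖β y‖ ≤ C) : IsBddField (dotField β) := by
  refine ⟨by unfold dotField; fun_prop, C * ∑ j : Fin 2,
    ‖(EuclideanSpace.proj j : EuclideanSpace ℂ (Fin 2) →L[ℂ] ℂ)‖, fun y => ?_⟩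
  rw [dotField, Finset.mul_sum]
  refine (norm_sum_le _ _).trans (Finset.sum_le_sum fun j _ => ?_)
  rw [norm_smul]
  gcongr
  exact (PiLp.norm_apply_le _ _).trans (hC y)

theorem mulL2_eq_fieldOp {g : E2 → ℂ} (hg : IsBddField (scalarField ℂ g)) (f : L2) :
    mulL2 g f = fieldOp (scalarField ℂ g) hg f := by
  have h : (fieldOp (scalarField ℂ g) hg f : E2 → ℂ) =ᵐ[volume] fun y => g y * f y :=
    (coeFn_fieldOp hg f).trans (ae_of_all _ fun y => by simp [scalarField])
  have hm : MemLp (fun y => g y * f y) 2 (volume : Measure E2) := (memLp_congr_ae h).1 (Lp.memLp _)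
  rw [mulL2, dif_pos hm]
  exact Lp.ext (hm.coeFn_toLp.trans h.symm)

end Multiplication

section Calculus

/-- Lets a singular potential be multiplied by a function whose closed support keeps away from the
singularities. -/
theorem contDiff_of_forall_tsupport {F : Type*} [NormedAddCommGroup F] [NormedSpace ℝ F]
    {f : E2 → F} {k : WithTop ℕ∞} (h : ∀ y ∈ tsupport f, ContDiffAt ℝ k f y) : ContDiff ℝ k f := by
  rw [contDiff_iff_contDiffAt]
  intro y
  by_cases hy : y ∈ tsupport f
  · exact h y hy
  · exact contDiffAt_const.congr_of_eventuallyEq (notMem_tsupport_iff_eventuallyEq.1 hy)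

theorem contDiff_partialDeriv {φ : E2 → ℂ} {k l : WithTop ℕ∞} (hφ : ContDiff ℝ l φ) (hk : k + 1 ≤ l)
    (j : Fin 2) : ContDiff ℝ k (partialDeriv j φ) :=
  (hφ.fderiv_right hk).clm_apply contDiff_const

theorem tsupport_partialDeriv_subset (j : Fin 2) (φ : E2 → ℂ) :
    tsupport (partialDeriv j φ) ⊆ tsupport φ :=
  tsupport_fderiv_apply_subset ℝ _

theorem partialDeriv_mul {f g : E2 → ℂ} {y : E2} (hf : DifferentiableAt ℝ f y)
    (hg : DifferentiableAt ℝ g y) (j : Fin 2) :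
    partialDeriv j (fun y => f y * g y) y = partialDeriv j f y * g y + f y * partialDeriv j g y := by
  simp only [partialDeriv, fderiv_fun_mul hf hg, _root_.add_apply,
    _root_.smul_apply, smul_eq_mul]
  ring

theorem partialDeriv_conj (f : E2 → ℂ) (y : E2) (j : Fin 2) :
    partialDeriv j (fun y => starRingEnd ℂ (f y)) y = starRingEnd ℂ (partialDeriv j f y) := by
  have := (conjCLE : ℂ ≃L[ℝ] ℂ).comp_fderiv (f := f) (x := y)
  simp only [partialDeriv]
  exact congr($this (EuclideanSpace.single j 1))

theorem integral_partialDeriv_eq_zero {f : E2 → ℂ} (hf : ContDiff ℝ 1 f) (hc : HasCompactSupport f)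
    (j : Fin 2) : ∫ y, partialDeriv j f y = 0 := by
  have hi : Integrable (partialDeriv j f) :=
    (contDiff_partialDeriv (k := 0) hf le_rfl j).continuous.integrable_of_hasCompactSupport
      (hc.mono' ((subset_tsupport _).trans (tsupport_partialDeriv_subset j f)))
  have h := integral_mul_fderiv_eq_neg_fderiv_mul_of_integrable (μ := (volume : Measure E2))
    (f := fun _ : E2 => (1 : ℂ)) (g := f) (v := EuclideanSpace.single j 1) (by simp)
    (by simpa using! hi) (by simpa using hf.continuous.integrable_of_hasCompactSupport hc)
    (fun _ _ => differentiableAt_const _) (fun y _ => (hf.differentiable (by simp)) y)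
  simpa using! h

variable {N : ℕ} {α : Fin N → ℝ} {x : Fin N → E2} {s s' : Finset (Fin N)}

theorem contDiffAt_potential {k : WithTop ℕ∞} {y : E2} (h : ∀ n ∈ s, y ≠ x n) :
    ContDiffAt ℝ k (potential α x s) y := by
  unfold potential
  refine ContDiffAt.sum fun n hn =>
    ContDiffAt.smul (f := fun y => α n / ‖y - x n‖ ^ 2) (g := fun y => perp (y - x n)) ?_ ?_
  · have : ‖y - x n‖ ^ 2 ≠ 0 := by simpa [sub_eq_zero] using h n hn
    exact contDiffAt_const.div ((contDiffAt_id.sub contDiffAt_const).norm_sq ℝ) this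
  · refine ContDiff.contDiffAt ?_
    rw [contDiff_euclidean]
    intro i
    fin_cases i <;> simp only [perp] <;> simp <;> fun_prop

theorem norm_perp (v : E2) : ‖perp v‖ = ‖v‖ := by
  simp [perp, EuclideanSpace.norm_eq, Fin.sum_univ_two, add_comm]

/-- Needed on the support of `ξ none`, which is not compact. -/
theorem norm_potential_le {ρ : ℝ} (hρ : 0 < ρ) {y : E2} (h : ∀ n ∈ s, ρ ≤ ‖y - x n‖) :
    ‖potential α x s y‖ ≤ ∑ n ∈ s, |α n| / ρ := by
  refine (norm_sum_le _ _).trans (Finset.sum_le_sum fun n hn => ?_)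
  have h1 : 0 < ‖y - x n‖ := hρ.trans_le (h n hn)
  rw [norm_smul, norm_perp, Real.norm_eq_abs, abs_div, abs_pow, abs_norm]
  calc |α n| / ‖y - x n‖ ^ 2 * ‖y - x n‖ = |α n| / ‖y - x n‖ := by field_simp
    _ ≤ _ := by gcongr; exact h n hn

theorem potential_add_potential_compl (y : E2) :
    potential α x s y + potential α x sᶜ y = potential α x Finset.univ y :=
  Finset.sum_add_sum_compl s _

/-- The value of `k` is irrelevant: only the radial direction of the gradient enters the divergence.
-/
theorem hasFDerivAt_const_div_norm_sub_sq (a : ℝ) {c y : E2} (h : y ≠ c) :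
    ∃ k : ℝ, HasFDerivAt (fun y' : E2 => a / ‖y' - c‖ ^ 2) (k • innerSL ℝ (y - c)) y := by
  have h0 : ‖y - c‖ ^ 2 ≠ 0 := by simpa [sub_eq_zero] using h
  have h1 : HasFDerivAt (fun y' : E2 => ‖y' - c‖ ^ 2) ((2 : ℝ) • innerSL ℝ (y - c)) y := by
    have := ((hasFDerivAt_id y).sub_const c).norm_sq
    refine this.congr_fderiv ?_
    ext v
    simp
  refine ⟨-(‖y - c‖ ^ 2 ^ 2)⁻¹ * a * 2, ?_⟩
  have h2 := ((hasDerivAt_inv h0).comp_hasFDerivAt y h1).const_mul a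
  convert! h2 using 1
  simp only [smul_smul]
  ring_nf

/-- The potential is divergence free away from the fluxes. -/
theorem div_potential {y : E2} (h : ∀ n ∈ s, y ≠ x n) :
    ∑ j : Fin 2, fderiv ℝ (fun y' => potential α x s y' j) y (EuclideanSpace.single j 1) = 0 := by
  have hd : ∀ j : Fin 2, ∀ n ∈ s, DifferentiableAt ℝ
      (fun y' => (α n / ‖y' - x n‖ ^ 2) * perp (y' - x n) j) y := fun j n hn => by
    obtain ⟨k, hk⟩ := hasFDerivAt_const_div_norm_sub_sq (α n) (h n hn)
    refine hk.differentiableAt.mul ?_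
    fin_cases j <;> simp [perp] <;> fun_prop
  have hs : ∀ j : Fin 2, fderiv ℝ (fun y' => potential α x s y' j) y =
      ∑ n ∈ s, fderiv ℝ (fun y' => (α n / ‖y' - x n‖ ^ 2) * perp (y' - x n) j) y := fun j => by
    rw [← fderiv_fun_sum (hd j)]
    congr 1
    ext y'
    simp [potential]
  simp only [hs, _root_.sum_apply]
  rw [Finset.sum_comm]
  refine Finset.sum_eq_zero fun n hn => ?_
  obtain ⟨k, hk⟩ := hasFDerivAt_const_div_norm_sub_sq (α n) (h n hn)
  have h0 : HasFDerivAt (fun y' : E2 => perp (y' - x n) 0) (-EuclideanSpace.proj (𝕜 := ℝ) 1) y := by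
    have := ((EuclideanSpace.proj (𝕜 := ℝ) (1 : Fin 2)).hasFDerivAt (x := y - x n)).neg.comp y
      ((hasFDerivAt_id y).sub_const (x n))
    simpa [perp, Function.comp_def] using! this
  have h1 : HasFDerivAt (fun y' : E2 => perp (y' - x n) 1) (EuclideanSpace.proj (𝕜 := ℝ) 0) y := by
    have := ((EuclideanSpace.proj (𝕜 := ℝ) (0 : Fin 2)).hasFDerivAt (x := y - x n)).comp y
      ((hasFDerivAt_id y).sub_const (x n))
    simpa [perp, Function.comp_def] using! this
  -- The radial gradient is orthogonal to `perp (y - x n)`, and the rotation field itself is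
  -- divergence free.
  rw [Fin.sum_univ_two, (hk.fun_mul h0).fderiv, (hk.fun_mul h1).fderiv]
  simp [perp, EuclideanSpace.inner_single_right]
  ring

end Calculus

end

/-! ### The magnetic gradient on `C¹` functions and its closure. -/

section

section MagneticGradient

theorem tsupport_component_subset (G : E2 → EuclideanSpace ℂ (Fin 2)) (j : Fin 2) :
    tsupport (fun y => G y j) ⊆ tsupport G :=
  closure_mono fun y hy h0 => hy (by simp [h0])

theorem magGrad_apply (A : E2 → E2) (φ : E2 → ℂ) (y : E2) (j : Fin 2) :
    magGrad A φ y j = -I * partialDeriv j φ y + (A y j : ℂ) * φ y := rfl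

theorem tsupport_magGrad_subset (A : E2 → E2) (φ : E2 → ℂ) :
    tsupport (magGrad A φ) ⊆ tsupport φ := by
  refine closure_minimal (fun y hy => ?_) (isClosed_tsupport φ)
  by_contra h
  refine hy ?_
  ext j
  have h1 : partialDeriv j φ y = 0 :=
    image_eq_zero_of_notMem_tsupport fun h' => h (tsupport_partialDeriv_subset j φ h')
  simp [magGrad_apply, h1, image_eq_zero_of_notMem_tsupport h]

theorem contDiff_magGrad {A : E2 → E2} {φ : E2 → ℂ} {k l : WithTop ℕ∞}
    (hA : ∀ y ∈ tsupport φ, ContDiffAt ℝ k A y) (hφ : ContDiff ℝ l φ) (hk : k + 1 ≤ l) :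
    ContDiff ℝ k (magGrad A φ) := by
  refine contDiff_of_forall_tsupport fun y hy => ?_
  rw [contDiffAt_piLp 2]
  intro j
  have h1 := (contDiffAt_euclidean.1 (hA y (tsupport_magGrad_subset A φ hy))) j
  exact (contDiffAt_const.mul (contDiff_partialDeriv hφ hk j).contDiffAt).add
    ((ofRealCLM.contDiff.contDiffAt.comp y h1).mul
      (hφ.of_le (le_self_add.trans hk)).contDiffAt)

/-- The potential may be shared between the factors; later the function takes the single flux and
the cutoff takes the regular part. -/
theorem magGrad_mul {A B C : E2 → E2} {f g : E2 → ℂ} {y : E2} (hf : DifferentiableAt ℝ f y)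
    (hg : DifferentiableAt ℝ g y) (h : C y = A y + B y) :
    magGrad C (fun y => g y * f y) y = g y • magGrad A f y + f y • magGrad B g y := by
  ext j
  simp only [magGrad_apply, partialDeriv_mul hg hf, h, PiLp.add_apply, PiLp.smul_apply, smul_eq_mul]
  push_cast
  ring

/-- Conjugation reverses the charge, so the conjugate cutoff goes with minus the regular part and
removes fluxes instead of adding them. -/
theorem magGrad_neg_conj (A : E2 → E2) (g : E2 → ℂ) (y : E2) (j : Fin 2) :
    magGrad (-A) (fun y => starRingEnd ℂ (g y)) y j = -starRingEnd ℂ (magGrad A g y j) := by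
  simp [magGrad_apply, partialDeriv_conj]
  ring

/-- The real potential cancels and the difference of the integrands is a multiple of a partial
derivative of `φ̄ g`, which has compact support. -/
theorem integral_conj_magGrad_mul {A : E2 → E2} {φ g : E2 → ℂ} (hφ : ContDiff ℝ 1 φ)
    (hc : HasCompactSupport φ) (hA : ∀ y ∈ tsupport φ, ContDiffAt ℝ 0 A y) (hg : ContDiff ℝ 1 g)
    (j : Fin 2) :
    ∫ y, starRingEnd ℂ (magGrad A φ y j) * g y = ∫ y, starRingEnd ℂ (φ y) * magGrad A g y j := by
  have hm : Continuous (magGrad A φ) := (contDiff_magGrad (k := 0) hA hφ le_rfl).continuous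
  have hmc : HasCompactSupport (magGrad A φ) :=
    hc.mono' ((subset_tsupport _).trans (tsupport_magGrad_subset A φ))
  have hpc : Continuous (fun y => starRingEnd ℂ (φ y)) := continuous_conj.comp hφ.continuous
  have hcc : HasCompactSupport (fun y => starRingEnd ℂ (φ y)) := hc.comp_left (map_zero _)
  have hprod : ContDiff ℝ 1 (fun y => starRingEnd ℂ (φ y) * g y) :=
    (conjCLE.contDiff.comp hφ).mul hg
  have hpd := (contDiff_partialDeriv (k := 0) hg le_rfl j).continuous
  have hpdp := (contDiff_partialDeriv (k := 0) hprod le_rfl j).continuous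
  have hpoint : ∀ y, starRingEnd ℂ (φ y) * magGrad A g y j = starRingEnd ℂ (magGrad A φ y j) * g y
      + -I * partialDeriv j (fun y => starRingEnd ℂ (φ y) * g y) y := fun y => by
    have h1 : DifferentiableAt ℝ (fun y => starRingEnd ℂ (φ y)) y :=
      (conjCLE.contDiff.comp hφ).differentiable (by simp) y
    rw [partialDeriv_mul h1 (hg.differentiable (by simp) y), partialDeriv_conj]
    simp [magGrad_apply]
    ring
  simp only [hpoint]
  rw [integral_add, integral_const_mul,
    integral_partialDeriv_eq_zero hprod (hcc.mul_right), mul_zero, add_zero]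
  · refine Continuous.integrable_of_hasCompactSupport ?_ ?_
    · exact (continuous_conj.comp ((EuclideanSpace.proj (𝕜 := ℂ) j).continuous.comp hm)).mul
        hg.continuous
    · exact HasCompactSupport.mul_right (hmc.comp_left
        (g := fun v : EuclideanSpace ℂ (Fin 2) => starRingEnd ℂ (v j)) (by simp))
  · refine (Continuous.integrable_of_hasCompactSupport hpdp ?_).const_mul _
    exact hcc.mul_right.mono' ((subset_tsupport _).trans (tsupport_partialDeriv_subset j _))

variable {N : ℕ} {α : Fin N → ℝ} {x : Fin N → E2} {s s' : Finset (Fin N)}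

/-- Continuously differentiable compactly supported functions whose support avoids the fluxes with
label in `s`. -/
def IsC1TestFunction (x : Fin N → E2) (s : Finset (Fin N)) (φ : E2 → ℂ) : Prop :=
  ContDiff ℝ 1 φ ∧ HasCompactSupport φ ∧ ∀ n ∈ s, x n ∉ tsupport φ

theorem IsTestFunction.isC1TestFunction {φ : E2 → ℂ} (h : IsTestFunction x s φ) :
    IsC1TestFunction x s φ :=
  ⟨h.1.of_le (by exact_mod_cast le_top), h.2⟩

namespace IsC1TestFunction

variable {φ : E2 → ℂ}

theorem contDiffAt_potential (h : IsC1TestFunction x s φ) {k : WithTop ℕ∞} {y : E2}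
    (hy : y ∈ tsupport φ) : ContDiffAt ℝ k (potential α x s) y :=
  AharonovBohm.contDiffAt_potential fun n hn h' => h.2.2 n hn (h' ▸ hy)

theorem continuous_magGrad (h : IsC1TestFunction x s φ) :
    Continuous (magGrad (potential α x s) φ) :=
  (contDiff_magGrad (k := 0) (fun _ hy => h.contDiffAt_potential hy) h.1 le_rfl).continuous

theorem hasCompactSupport_magGrad (h : IsC1TestFunction x s φ) (A : E2 → E2) :
    HasCompactSupport (magGrad A φ) :=
  h.2.1.mono' ((subset_tsupport _).trans (tsupport_magGrad_subset A φ))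

theorem memLp (h : IsC1TestFunction x s φ) : MemLp φ 2 (volume : Measure E2) :=
  h.1.continuous.memLp_of_hasCompactSupport h.2.1

theorem memLp_magGrad (h : IsC1TestFunction x s φ) :
    MemLp (magGrad (potential α x s) φ) 2 (volume : Measure E2) :=
  h.continuous_magGrad.memLp_of_hasCompactSupport (h.hasCompactSupport_magGrad _)

/-- The cutoffs are only `C²`, so their products with smooth test functions need not be smooth; this
is why the `C¹` class is used. -/
theorem mul {g : E2 → ℂ} (h : IsC1TestFunction x s φ) (hg : ContDiff ℝ 1 g)
    (hs : ∀ n ∈ s', n ∉ s → x n ∉ tsupport g) : IsC1TestFunction x s' (fun y => g y * φ y) := by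
  refine ⟨hg.mul h.1, h.2.1.mul_left, fun n hn h' => ?_⟩
  by_cases hns : n ∈ s
  · exact h.2.2 n hns (tsupport_mul_subset_right h')
  · exact hs n hn hns (tsupport_mul_subset_left h')

end IsC1TestFunction

theorem isOpen_avoid (x : Fin N → E2) (s : Finset (Fin N)) : IsOpen {y | ∀ n ∈ s, y ≠ x n} := by
  have : {y | ∀ n ∈ s, y ≠ x n} = ((s.image x : Finset E2) : Set E2)ᶜ := by
    ext y; simp [eq_comm]
  rw [this]
  exact (s.image x).finite_toSet.isClosed.isOpen_compl

theorem ae_avoid (x : Fin N → E2) (s : Finset (Fin N)) : ∀ᵐ y : E2, ∀ n ∈ s, y ≠ x n := by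
  rw [Finset.eventually_all]
  intro n _
  exact (Set.countable_singleton (x n)).ae_notMem volume

/-- Smooth approximation of a compactly supported `C¹` function, uniform up to first derivatives,
with control of the support. -/
theorem exists_smooth_approx {φ : E2 → ℂ} (hφ : ContDiff ℝ 1 φ) (hc : HasCompactSupport φ)
    {δ η : ℝ} (hδ : 0 < δ) (hη : 0 < η) :
    ∃ ψ : E2 → ℂ, ContDiff ℝ ∞ ψ ∧ tsupport ψ ⊆ Metric.cthickening δ (tsupport φ) ∧
      (∀ y, dist (ψ y) (φ y) ≤ η) ∧
      ∀ j y, dist (partialDeriv j ψ y) (partialDeriv j φ y) ≤ η := by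
  have hdc : ∀ j, Continuous (partialDeriv j φ) := fun j =>
    (contDiff_partialDeriv (k := 0) hφ le_rfl j).continuous
  have hds : ∀ j, HasCompactSupport (partialDeriv j φ) := fun j =>
    hc.mono' ((subset_tsupport _).trans (tsupport_partialDeriv_subset j φ))
  have hu : UniformContinuous fun y => (φ y, partialDeriv 0 φ y, partialDeriv 1 φ y) :=
    (hc.uniformContinuous_of_continuous hφ.continuous).prodMk
      (((hds 0).uniformContinuous_of_continuous (hdc 0)).prodMk
        ((hds 1).uniformContinuous_of_continuous (hdc 1)))
  obtain ⟨ρ, hρ, hρ'⟩ := Metric.uniformContinuous_iff.1 hu η hη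
  -- The radius stays below `ρ` for the uniform estimates and below `δ` for the support.
  set b : ContDiffBump (0 : E2) := ⟨min ρ δ / 2, min ρ δ, by positivity, by
    linarith [lt_min hρ hδ]⟩
  have hb : b.rOut = min ρ δ := rfl
  have hclose : ∀ y, ∀ y' ∈ Metric.ball y b.rOut, dist (φ y') (φ y) ≤ η ∧
      ∀ j, dist (partialDeriv j φ y') (partialDeriv j φ y) ≤ η := fun y y' hy => by
    have h := hρ' ((Metric.mem_ball.1 hy).trans_le (min_le_left _ _))
    simp only [Prod.dist_eq, max_lt_iff] at h
    exact ⟨h.1.le, Fin.forall_fin_two.2 ⟨h.2.1.le, h.2.2.le⟩⟩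
  have hloc : LocallyIntegrable (b.normed volume) := b.continuous_normed.locallyIntegrable
  refine ⟨convolution (b.normed volume) φ (ContinuousLinearMap.lsmul ℝ ℝ) volume, ?_, ?_,
    fun y => ?_, fun j y => ?_⟩
  · exact b.hasCompactSupport_normed.contDiff_convolution_left _ b.contDiff_normed
      hφ.continuous.locallyIntegrable
  · refine closure_minimal ((support_convolution_subset _).trans ?_) Metric.isClosed_cthickening
    rw [b.support_normed_eq, hb]
    rintro _ ⟨u, hu, v, hv, rfl⟩
    refine Metric.mem_cthickening_of_dist_le _ v _ _ (subset_tsupport _ hv) ?_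
    rw [Metric.mem_ball, dist_zero_right] at hu
    simpa using hu.le.trans (min_le_right _ _)
  · exact b.dist_normed_convolution_le hφ.continuous.aestronglyMeasurable
      fun y' hy' => (hclose y y' hy').1
  · have h1 := hc.hasFDerivAt_convolution_right (ContinuousLinearMap.lsmul ℝ ℝ) hloc hφ y
    rw [partialDeriv, h1.fderiv, convolution_precompR_apply _ hloc (hc.fderiv ℝ)
      (hφ.continuous_fderiv one_ne_zero)]
    exact b.dist_normed_convolution_le (g := partialDeriv j φ) (hdc j).aestronglyMeasurable
      fun y' hy' => (hclose y y' hy').2 j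

theorem dist_magGrad_le {A : E2 → E2} {φ ψ : E2 → ℂ} {y : E2} {C η : ℝ} (hA : ‖A y‖ ≤ C)
    (h : dist (ψ y) (φ y) ≤ η)
    (h' : ∀ j, dist (partialDeriv j ψ y) (partialDeriv j φ y) ≤ η) :
    dist (magGrad A ψ y) (magGrad A φ y) ≤ 2 * ((1 + C) * η) := by
  have hη : 0 ≤ η := dist_nonneg.trans h
  have hj : ∀ j, ‖(magGrad A ψ y - magGrad A φ y) j‖ ≤ (1 + C) * η := fun j => by
    have : (magGrad A ψ y - magGrad A φ y) j = -I * (partialDeriv j ψ y - partialDeriv j φ y)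
        + (A y j : ℂ) * (ψ y - φ y) := by
      simp only [PiLp.sub_apply, magGrad_apply]
      ring
    rw [this]
    refine (norm_add_le _ _).trans ?_
    rw [norm_mul, norm_mul, norm_neg, norm_I, ← dist_eq_norm, ← dist_eq_norm, norm_real]
    have h2 : ‖A y j‖ ≤ C := (PiLp.norm_apply_le _ _).trans hA
    nlinarith [h' j, norm_nonneg (A y j), mul_le_mul h2 h dist_nonneg ((norm_nonneg _).trans hA)]
  rw [dist_eq_norm]
  calc ‖magGrad A ψ y - magGrad A φ y‖
      ≤ ∑ j, ‖(magGrad A ψ y - magGrad A φ y) j‖ := by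
        conv_lhs => rw [← (EuclideanSpace.basisFun (Fin 2) ℂ).sum_repr
          (magGrad A ψ y - magGrad A φ y)]
        refine (norm_sum_le _ _).trans (Finset.sum_le_sum fun j _ => ?_)
        simp [norm_smul]
    _ ≤ _ := by rw [Fin.sum_univ_two]; linarith [hj 0, hj 1]

theorem dist_toLp_le_of_forall_dist_le {F : Type*} [NormedAddCommGroup F] {f g : E2 → F}
    (hf : MemLp f 2 (volume : Measure E2)) (hg : MemLp g 2 (volume : Measure E2)) {K : Set E2}
    (hK : IsCompact K) (hfK : Function.support f ⊆ K) (hgK : Function.support g ⊆ K) {c : ℝ}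
    (h : ∀ y, dist (f y) (g y) ≤ c) :
    dist (hf.toLp f) (hg.toLp g) ≤ c * (volume K ^ (1 / (2 : ENNReal).toReal)).toReal := by
  have hc : 0 ≤ c := dist_nonneg.trans (h 0)
  rw [dist_edist, Lp.edist_toLp_toLp, ← ENNReal.toReal_ofReal hc, ← ENNReal.toReal_mul]
  refine ENNReal.toReal_mono ?_ (eLpNorm_sub_le_of_dist_bdd _ (by simp) hK.measurableSet hc
    (by simpa using h) hfK hgK)
  exact ENNReal.mul_ne_top (by simp) (ENNReal.rpow_ne_top_of_nonneg (by positivity)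
    hK.measure_lt_top.ne)

/-- Approximation by smooth functions: the magnetic gradient of a `C¹` function belongs to the
closed magnetic gradient. -/
theorem IsC1TestFunction.mem_closure_minGraph {φ : E2 → ℂ} (h : IsC1TestFunction x s φ) :
    (h.memLp.toLp φ, h.memLp_magGrad.toLp (magGrad (potential α x s) φ)) ∈
      (minGraph α x s).topologicalClosure := by
  obtain ⟨δ, hδ, hδU⟩ := h.2.1.isCompact.exists_cthickening_subset_open (isOpen_avoid x s)
    fun y hy n hn h' => h.2.2 n hn (h' ▸ hy)
  set K := Metric.cthickening δ (tsupport φ)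
  have hK : IsCompact K := h.2.1.isCompact.cthickening
  have hKφ : tsupport φ ⊆ K := Metric.self_subset_cthickening _
  obtain ⟨C, hC⟩ := hK.exists_bound_of_continuousOn (f := potential α x s) fun y hy =>
    (AharonovBohm.contDiffAt_potential (k := 0) (hδU hy)).continuousAt.continuousWithinAt
  set m := (volume K ^ (1 / (2 : ENNReal).toReal)).toReal
  have hm : 0 ≤ m := ENNReal.toReal_nonneg
  refine Metric.mem_closure_iff.2 fun ε hε => ?_
  -- The `L²` errors will be `η m` and `2 (1 + |C|) η m`; this choice, with `m + 1` for `m`, keeps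
  -- both strictly below `ε`.
  set η : ℝ := ε / ((1 + 2 * (1 + |C|)) * (m + 1))
  have hη : 0 < η := by positivity
  obtain ⟨ψ, hψ, hψs, hψ0, hψ1⟩ := exists_smooth_approx h.1 h.2.1 hδ hη
  have hψt : IsTestFunction x s ψ := ⟨hψ, hK.of_isClosed_subset (isClosed_tsupport ψ) hψs,
    fun n hn h' => hδU (hψs h') n hn rfl⟩
  have hψ' := hψt.isC1TestFunction
  have hsub : ∀ f : E2 → ℂ, tsupport f ⊆ K → Function.support (magGrad (potential α x s) f) ⊆ K :=
    fun f hf => (subset_tsupport _).trans ((tsupport_magGrad_subset _ f).trans hf)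
  refine ⟨(hψ'.memLp.toLp ψ, hψ'.memLp_magGrad.toLp _),
    ⟨ψ, hψt, hψ'.memLp.coeFn_toLp, hψ'.memLp_magGrad.coeFn_toLp⟩, ?_⟩
  have hεη : (1 + 2 * (1 + |C|)) * η * (m + 1) = ε := by
    simp only [η]; field_simp
  have h1 := dist_toLp_le_of_forall_dist_le h.memLp hψ'.memLp hK
    ((subset_tsupport _).trans hKφ) ((subset_tsupport _).trans hψs) (c := η)
    (fun y => by rw [dist_comm]; exact hψ0 y)
  have h2 := dist_toLp_le_of_forall_dist_le (h.memLp_magGrad (α := α)) (hψ'.memLp_magGrad (α := α))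
    hK (hsub φ hKφ) (hsub ψ hψs) (c := 2 * ((1 + |C|) * η)) (fun y => by
      by_cases hy : y ∈ K
      · rw [dist_comm]
        exact dist_magGrad_le ((hC y hy).trans (le_abs_self C)) (hψ0 y) (fun j => hψ1 j y)
      · rw [Function.notMem_support.1 fun h' => hy (hsub φ hKφ h'),
          Function.notMem_support.1 fun h' => hy (hsub ψ hψs h'), dist_self]
        positivity)
  have hCη : 0 ≤ |C| * η := by positivity
  rw [Prod.dist_eq, max_lt_iff]
  constructor
  · refine h1.trans_lt ?_
    nlinarith [mul_nonneg hη.le hm, mul_nonneg hCη hm]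
  · refine h2.trans_lt ?_
    nlinarith [mul_nonneg hη.le hm, mul_nonneg hCη hm]

/-- Weak form of the magnetic gradient. -/
theorem inner_snd_eq_inner_fst_of_mem_closure {p : L2 × L2V}
    (hp : p ∈ (minGraph α x s).topologicalClosure) {G : E2 → EuclideanSpace ℂ (Fin 2)}
    (hG : ContDiff ℝ 1 G) (hc : HasCompactSupport G) (hs : ∀ n ∈ s, x n ∉ tsupport G)
    {w : L2V} (hw : w =ᵐ[volume] G) {f : L2}
    (hf : f =ᵐ[volume] fun y => ∑ j, magGrad (potential α x s) (fun y => G y j) y j) :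
    inner ℂ p.2 w = inner ℂ p.1 f := by
  -- For fixed `w` and `f` the identity is a closed condition on `p`, so it suffices to integrate by
  -- parts against test functions.
  have hclosed : IsClosed {p : L2 × L2V | inner ℂ p.2 w = inner ℂ p.1 f} :=
    isClosed_eq (by fun_prop) (by fun_prop)
  refine closure_minimal (fun p hp => ?_) hclosed hp
  obtain ⟨φ, hφ, h1, h2⟩ := hp
  have hφ' := hφ.isC1TestFunction
  have hGj : ∀ j, IsC1TestFunction x s (fun y => G y j) := fun j => by
    exact ⟨(contDiff_piLp 2).1 hG j, hc.comp_left (g := fun v : EuclideanSpace ℂ (Fin 2) => v j) rfl,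
      fun n hn h' => hs n hn (tsupport_component_subset G j h')⟩
  change inner ℂ p.2 w = inner ℂ p.1 f
  rw [L2.inner_def, L2.inner_def]
  have e1 : ∫ y, inner ℂ (p.2 y) (w y) =
      ∫ y, ∑ j, starRingEnd ℂ (magGrad (potential α x s) φ y j) * G y j := by
    refine integral_congr_ae ?_
    filter_upwards [h2, hw] with y a b
    rw [a, b, PiLp.inner_apply]
    exact Finset.sum_congr rfl fun j _ => by rw [RCLike.inner_apply, mul_comm]
  have e2 : ∫ y, inner ℂ (p.1 y) (f y) = ∫ y, ∑ j, starRingEnd ℂ (φ y) *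
      magGrad (potential α x s) (fun y => G y j) y j := by
    refine integral_congr_ae ?_
    filter_upwards [h1, hf] with y a b
    rw [a, b, RCLike.inner_apply, mul_comm, Finset.mul_sum]
  rw [e1, e2, integral_finsetSum, integral_finsetSum]
  · exact Finset.sum_congr rfl fun j _ => integral_conj_magGrad_mul hφ'.1 hφ'.2.1
      (fun y hy => hφ'.contDiffAt_potential hy) (hGj j).1 j
  · intro j _
    refine Continuous.integrable_of_hasCompactSupport ?_ ?_
    · exact (continuous_conj.comp hφ'.1.continuous).mul
        ((EuclideanSpace.proj (𝕜 := ℂ) j).continuous.comp (hGj j).continuous_magGrad)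
    · exact HasCompactSupport.mul_right (hφ'.2.1.comp_left (map_zero _))
  · intro j _
    refine Continuous.integrable_of_hasCompactSupport ?_ ?_
    · exact (continuous_conj.comp ((EuclideanSpace.proj (𝕜 := ℂ) j).continuous.comp
        hφ'.continuous_magGrad)).mul (hGj j).1.continuous
    · exact HasCompactSupport.mul_left ((hGj j).2.1)

/-- A locally integrable function that integrates to zero against all real test functions that avoid
the fluxes vanishes. -/
theorem ae_eq_zero_of_forall_testFunction {f : E2 → ℂ} (hf : LocallyIntegrable f)
    (h : ∀ g : E2 → ℝ, IsTestFunction x s (fun y => (g y : ℂ)) → ∫ y, g y • f y = 0) :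
    f =ᵐ[volume] 0 := by
  have := (isOpen_avoid x s).ae_eq_zero_of_integral_contDiff_smul_eq_zero (f := f)
    (hf.locallyIntegrableOn _) fun g hg hc hs => h g ⟨ofRealCLM.contDiff.comp hg,
      hc.comp_left (g := fun t : ℝ => (t : ℂ)) ofReal_zero, fun n hn h' => ?_⟩
  · filter_upwards [this, ae_avoid x s] with y h1 h2 using h1 h2
  · exact hs (closure_mono (Function.support_subset_iff'.2 fun y hy => by simpa using hy) h') n hn rfl

/-- Closability, which makes `formGrad` a true closure. By the weak form, `p.2` pairs to zero with
every vector field `g e_j` supported off the fluxes, and the fluxes are a null set. -/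
theorem snd_eq_zero_of_mem_closure_minGraph (p : L2 × L2V)
    (hp : p ∈ (minGraph α x s).topologicalClosure) (h0 : p.1 = 0) : p.2 = 0 := by
  have hcomp : ∀ j : Fin 2, (fun y => p.2 y j) =ᵐ[volume] 0 := fun j => by
    have hloc : LocallyIntegrable (fun y => p.2 y j) := by
      have h1 : MemLp (fun y => p.2 y j) 2 (volume : Measure E2) :=
        (EuclideanSpace.proj (𝕜 := ℂ) j).comp_memLp' (Lp.memLp p.2)
      exact h1.locallyIntegrable (by norm_num)
    refine ae_eq_zero_of_forall_testFunction (x := x) (s := s) hloc fun g hg => ?_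
    have hg1 := hg.isC1TestFunction
    set G : E2 → EuclideanSpace ℂ (Fin 2) := fun y => EuclideanSpace.single j (g y : ℂ)
    have hG : ContDiff ℝ 1 G := by
      rw [contDiff_piLp 2]
      intro i
      by_cases hi : i = j
      · subst hi; simpa [G] using hg1.1
      · simpa [G, hi] using contDiff_const
    have hsub : tsupport G ⊆ tsupport fun y => (g y : ℂ) :=
      closure_mono fun y hy h0 => hy (by simpa [G] using h0)
    have hGc : HasCompactSupport G := hg1.2.1.mono' ((subset_tsupport _).trans hsub)
    have hGj : ∀ i, IsC1TestFunction x s (fun y => G y i) := fun i =>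
      ⟨(contDiff_piLp 2).1 hG i, hGc.comp_left (g := fun v : EuclideanSpace ℂ (Fin 2) => v i) rfl,
        fun n hn h' => hg1.2.2 n hn (hsub (tsupport_component_subset G i h'))⟩
    have hm : MemLp (fun y => ∑ i, magGrad (potential α x s) (fun y => G y i) y i) 2
        (volume : Measure E2) := memLp_finsetSum _ fun i _ =>
      (EuclideanSpace.proj (𝕜 := ℂ) i).comp_memLp' (hGj i).memLp_magGrad
    have hGm : MemLp G 2 (volume : Measure E2) := hG.continuous.memLp_of_hasCompactSupport hGc
    have key := inner_snd_eq_inner_fst_of_mem_closure hp hG hGc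
      (fun n hn h' => hg1.2.2 n hn (hsub h')) hGm.coeFn_toLp hm.coeFn_toLp
    rw [h0, inner_zero_left, L2.inner_def] at key
    have key2 := congr(starRingEnd ℂ $key)
    rw [← integral_conj, map_zero] at key2
    rw [← key2]
    refine integral_congr_ae ?_
    filter_upwards [hGm.coeFn_toLp] with y hy
    rw [hy]
    simp [G, EuclideanSpace.inner_single_right]
  refine Lp.ext ?_
  filter_upwards [hcomp 0, hcomp 1, Lp.coeFn_zero (EuclideanSpace ℂ (Fin 2)) 2 (volume : Measure E2)]
    with y h1 h2 h3
  rw [h3]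
  ext j
  fin_cases j
  · exact h1
  · exact h2

/-- Only `0` is orthogonal to the domain of the closed magnetic gradient. -/
theorem eq_zero_of_forall_inner_eq_zero {f : L2}
    (h : ∀ p ∈ (minGraph α x s).topologicalClosure, inner ℂ p.1 f = 0) : f = 0 := by
  refine Lp.ext (Filter.EventuallyEq.trans ?_ (Lp.coeFn_zero _ _ _).symm)
  refine ae_eq_zero_of_forall_testFunction (x := x) (s := s)
    ((Lp.memLp f).locallyIntegrable (by norm_num)) fun g hg => ?_
  have hg1 := hg.isC1TestFunction
  have := h _ (Submodule.le_topologicalClosure (minGraph α x s)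
    (show (hg1.memLp.toLp _, hg1.memLp_magGrad.toLp _) ∈ minGraph α x s from
      ⟨_, hg, hg1.memLp.coeFn_toLp, hg1.memLp_magGrad.coeFn_toLp⟩))
  rw [L2.inner_def] at this
  rw [← this]
  refine integral_congr_ae ?_
  filter_upwards [hg1.memLp.coeFn_toLp] with y hy
  simp only [hy, RCLike.inner_apply, conj_ofReal, real_smul]
  ring

end MagneticGradient

end

/-! ### Shifted forms, the form domain as a Hilbert space, and Friedrichs resolvents. -/

section

variable {N : ℕ} {α : Fin N → ℝ} {x : Fin N → E2} {s : Finset (Fin N)}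

section GraphNorm

open ContinuousLinearMap

theorem norm_sq_of_graphNorm {V H K : Type*} [NormedAddCommGroup V] [InnerProductSpace ℂ V]
    [NormedAddCommGroup H] [InnerProductSpace ℂ H] [NormedAddCommGroup K] [InnerProductSpace ℂ K]
    {e : V →L[ℂ] H} {D : V →L[ℂ] K}
    (h : ∀ v u, inner ℂ v u = inner ℂ (e v) (e u) + inner ℂ (D v) (D u))
    (v : V) : ‖v‖ ^ 2 = ‖e v‖ ^ 2 + ‖D v‖ ^ 2 := by
  have := h v v
  rw [inner_self_eq_norm_sq_to_K, inner_self_eq_norm_sq_to_K, inner_self_eq_norm_sq_to_K] at this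
  exact_mod_cast this

variable {V H K : Type*} [NormedAddCommGroup V] [InnerProductSpace ℂ V] [CompleteSpace V]
  [NormedAddCommGroup H] [InnerProductSpace ℂ H] [CompleteSpace H]
  [NormedAddCommGroup K] [InnerProductSpace ℂ K]

/-- Let `V` carry the graph norm of `D`, and let `e` be its inclusion in `H`. The operator on `V`
that represents the form of `D* D - z`. -/
def shiftedForm (e : V →L[ℂ] H) (z : ℂ) : V →L[ℂ] V := 1 - (1 + z) • (adjoint e ∘L e)

/-- The solution operator `f ↦ (D* D - z)⁻¹ f` with values in the form domain `V`. -/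
def shiftedFormSolve (e : V →L[ℂ] H) (z : ℂ) : H →L[ℂ] V :=
  Ring.inverse (shiftedForm e z) ∘L adjoint e

variable {e : V →L[ℂ] H} {D : V →L[ℂ] K} {z : ℂ}

/-- The `1` in `1 + z` removes the `L²` part of the graph inner product. -/
theorem inner_shiftedForm (h : ∀ v u, inner ℂ v u = inner ℂ (e v) (e u) + inner ℂ (D v) (D u))
    (v u : V) :
    inner ℂ v (shiftedForm e z u) = inner ℂ (D v) (D u) - z * inner ℂ (e v) (e u) := by
  rw [shiftedForm, _root_.sub_apply, one_apply_eq_self, _root_.smul_apply,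
    ContinuousLinearMap.comp_apply, inner_sub_right, inner_smul_right, adjoint_inner_right, h v u]
  ring

/-- The constant depends on `τ` and `z` only, hence is shared by all the form domains, as
`localization_formula` requires. -/
theorem re_mul_inner_shiftedForm_ge
    (h : ∀ v u, inner ℂ v u = inner ℂ (e v) (e u) + inner ℂ (D v) (D u)) {τ : ℂ} (v : V) :
    min τ.re (-(τ * z)).re * ‖v‖ ^ 2 ≤ (τ * inner ℂ v (shiftedForm e z v)).re := by
  rw [inner_shiftedForm h, inner_self_eq_norm_sq_to_K, inner_self_eq_norm_sq_to_K,
    norm_sq_of_graphNorm h]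
  have h : (τ * (((‖D v‖ : ℝ) : ℂ) ^ 2 - z * ((‖e v‖ : ℝ) : ℂ) ^ 2)).re =
      τ.re * ‖D v‖ ^ 2 + (-(τ * z)).re * ‖e v‖ ^ 2 := by
    rw [mul_sub, ← mul_assoc, ← ofReal_pow, ← ofReal_pow, sub_re, re_mul_ofReal, re_mul_ofReal,
      neg_re]
    ring
  refine le_of_le_of_eq ?_ h.symm
  nlinarith [mul_le_mul_of_nonneg_right (min_le_left τ.re (-(τ * z)).re) (sq_nonneg ‖D v‖),
    mul_le_mul_of_nonneg_right (min_le_right τ.re (-(τ * z)).re) (sq_nonneg ‖e v‖)]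

theorem isUnit_shiftedForm
    (h : ∀ v u, inner ℂ v u = inner ℂ (e v) (e u) + inner ℂ (D v) (D u)) (hz : z ∉ halfLine) :
    IsUnit (shiftedForm e z) := by
  obtain ⟨τ, h1, h2⟩ := exists_rotation_pos hz
  exact isUnit_of_re_mul_inner_ge (lt_min h1 h2) (re_mul_inner_shiftedForm_ge h)

theorem inner_shiftedFormSolve
    (h : ∀ v u, inner ℂ v u = inner ℂ (e v) (e u) + inner ℂ (D v) (D u)) (hz : z ∉ halfLine)
    (f : H) (v : V) :
    inner ℂ (D v) (D (shiftedFormSolve e z f)) - z * inner ℂ (e v) (e (shiftedFormSolve e z f)) =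
      inner ℂ (e v) f := by
  have h1 : shiftedForm e z (shiftedFormSolve e z f) = adjoint e f :=
    congr($(Ring.mul_inverse_cancel _ (isUnit_shiftedForm h hz)) (adjoint e f))
  rw [← inner_shiftedForm h, h1, adjoint_inner_right]

theorem shiftedFormSolve_eq
    (h : ∀ v u, inner ℂ v u = inner ℂ (e v) (e u) + inner ℂ (D v) (D u)) (hz : z ∉ halfLine)
    {f : H} {u : V} (hu : ∀ v, inner ℂ (D v) (D u) - z * inner ℂ (e v) (e u) = inner ℂ (e v) f) :
    shiftedFormSolve e z f = u := by
  have h1 : shiftedForm e z u = adjoint e f := ext_inner_left ℂ fun v => by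
    rw [inner_shiftedForm h, hu, adjoint_inner_right]
  rw [shiftedFormSolve, ContinuousLinearMap.comp_apply, ← h1]
  exact congr($(Ring.inverse_mul_cancel _ (isUnit_shiftedForm h hz)) u)

/-- A commutator identity for forms as an identity of operators. -/
theorem shiftedForm_comp_eq {W : Type*} [NormedAddCommGroup W] [InnerProductSpace ℂ W]
    [CompleteSpace W] {e' : W →L[ℂ] H} {D' : W →L[ℂ] K}
    (h : ∀ v u, inner ℂ v u = inner ℂ (e v) (e u) + inner ℂ (D v) (D u))
    (h' : ∀ v u, inner ℂ v u = inner ℂ (e' v) (e' u) + inner ℂ (D' v) (D' u))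
    {T : W →L[ℂ] V} {M : V →L[ℂ] W} {p : W →L[ℂ] H}
    (hp : ∀ v u, inner ℂ (D v) (D (T u)) - z * inner ℂ (e v) (e (T u)) =
      inner ℂ (D' (M v)) (D' u) - z * inner ℂ (e' (M v)) (e' u) + inner ℂ (e v) (p u)) :
    shiftedForm e z ∘L T = adjoint M ∘L shiftedForm e' z + adjoint e ∘L p := by
  ext1 u
  refine ext_inner_left ℂ fun v => ?_
  rw [ContinuousLinearMap.comp_apply, inner_shiftedForm h, _root_.add_apply,
    inner_add_right, ContinuousLinearMap.comp_apply, ContinuousLinearMap.comp_apply,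
    adjoint_inner_right, adjoint_inner_right, inner_shiftedForm h', hp]

theorem isClosed_halfLine : IsClosed halfLine :=
  isometry_ofReal.isClosedEmbedding.isClosedMap _ isClosed_Ici

theorem halfLine_nonempty : halfLine.Nonempty := ⟨_, 0, Set.self_mem_Ici, rfl⟩

theorem infDist_halfLine_pos (hz : z ∉ halfLine) : 0 < Metric.infDist z halfLine :=
  (isClosed_halfLine.notMem_iff_infDist_pos halfLine_nonempty).1 hz

/-- The usual resolvent bound without the spectral theorem: testing the equation with its solution
`u` gives `(q - z)‖e u‖² = ⟪e u, f⟫`, and the Rayleigh quotient `q` lies on the half-line. -/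
theorem norm_incl_shiftedFormSolve_le
    (h : ∀ v u, inner ℂ v u = inner ℂ (e v) (e u) + inner ℂ (D v) (D u))
    (hz : z ∉ halfLine) (f : H) :
    Metric.infDist z halfLine * ‖e (shiftedFormSolve e z f)‖ ≤ ‖f‖ := by
  set u := shiftedFormSolve e z f
  rcases eq_or_ne (e u) 0 with h0 | h0
  · simp [h0]
  have hpos : 0 < ‖e u‖ := norm_pos_iff.2 h0
  have h' := inner_shiftedFormSolve h hz f u
  rw [inner_self_eq_norm_sq_to_K, inner_self_eq_norm_sq_to_K] at h'
  set q : ℝ := ‖D u‖ ^ 2 / ‖e u‖ ^ 2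
  have hq : Metric.infDist z halfLine ≤ dist z q :=
    Metric.infDist_le_dist_of_mem ⟨q, by simp only [Set.mem_Ici, q]; positivity, rfl⟩
  have h2 : ((q : ℂ) - z) * (‖e u‖ ^ 2 : ℝ) = inner ℂ (e u) f := by
    rw [← h', sub_mul, ← ofReal_mul, div_mul_cancel₀ _ (by positivity)]
    push_cast
    rfl
  have h3 : dist z q * ‖e u‖ ^ 2 ≤ ‖e u‖ * ‖f‖ := by
    have := congr(‖$h2‖)
    rw [norm_mul, norm_real, Real.norm_of_nonneg (by positivity), norm_sub_rev, ← dist_eq_norm]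
      at this
    exact this.trans_le (norm_inner_le_norm _ _)
  have h4 : dist z q * ‖e u‖ ≤ ‖f‖ := by
    rw [sq, ← mul_assoc, mul_comm, mul_le_mul_iff_right₀ hpos] at h3
    exact h3
  exact (mul_le_mul_of_nonneg_right hq hpos.le).trans h4

/-- The same test gives `‖D u‖² = ⟪e u, f⟫ + z‖e u‖²`; inserting `‖e u‖ ≤ ‖f‖ / d` produces the
smallness parameter of the theorem. -/
theorem norm_grad_shiftedFormSolve_sq_le
    (h : ∀ v u, inner ℂ v u = inner ℂ (e v) (e u) + inner ℂ (D v) (D u))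
    (hz : z ∉ halfLine) (f : H) :
    ‖D (shiftedFormSolve e z f)‖ ^ 2 ≤ 1 / Metric.infDist z halfLine *
      (1 + ‖z‖ / Metric.infDist z halfLine) * ‖f‖ ^ 2 := by
  set u := shiftedFormSolve e z f
  set d := Metric.infDist z halfLine
  have hd : 0 < d := infDist_halfLine_pos hz
  have h1 : ‖e u‖ ≤ ‖f‖ / d := by
    rw [le_div_iff₀' hd]
    exact norm_incl_shiftedFormSolve_le h hz f
  have h' := inner_shiftedFormSolve h hz f u
  rw [inner_self_eq_norm_sq_to_K, inner_self_eq_norm_sq_to_K,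
    sub_eq_iff_eq_add] at h'
  have h2 := congr(‖$h'‖)
  rw [norm_pow, RCLike.norm_ofReal, abs_norm] at h2
  rw [h2]
  calc _ ≤ ‖e u‖ * ‖f‖ + ‖z‖ * ‖e u‖ ^ 2 := by
        refine (norm_add_le _ _).trans (add_le_add (norm_inner_le_norm _ _) ?_)
        rw [norm_mul, norm_pow, RCLike.norm_ofReal, abs_norm]
    _ ≤ ‖f‖ / d * ‖f‖ + ‖z‖ * (‖f‖ / d) ^ 2 := by gcongr
    _ = _ := by field_simp

end GraphNorm

section FormSpace

open ContinuousLinearMap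

/-- The Friedrichs form domain of the fluxes in `s` as a Hilbert space with the graph norm. -/
def formSpace (α : Fin N → ℝ) (x : Fin N → E2) (s : Finset (Fin N)) :
    Submodule ℂ (WithLp 2 (L2 × L2V)) :=
  (minGraph α x s).topologicalClosure.comap
    (WithLp.prodContinuousLinearEquiv 2 ℂ L2 L2V).toLinearEquiv.toLinearMap

/-- The form domain as a type. -/
def FormSpace (α : Fin N → ℝ) (x : Fin N → E2) (s : Finset (Fin N)) : Type := formSpace α x s

instance : NormedAddCommGroup (FormSpace α x s) := inferInstanceAs
    (NormedAddCommGroup (formSpace α x s))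

instance : InnerProductSpace ℂ (FormSpace α x s) :=
  inferInstanceAs (InnerProductSpace ℂ (formSpace α x s))

instance : CompleteSpace (FormSpace α x s) :=
  ((Submodule.isClosed_topologicalClosure (minGraph α x s)).preimage
    (WithLp.prodContinuousLinearEquiv 2 ℂ L2 L2V).continuous).completeSpace_coe

/-- The inclusion of the form domain in `L²`. -/
def formIncl (α : Fin N → ℝ) (x : Fin N → E2) (s : Finset (Fin N)) : FormSpace α x s →L[ℂ] L2 :=
  WithLp.fstL 2 ℂ L2 L2V ∘L (formSpace α x s).subtypeL

/-- The magnetic gradient on the form domain. -/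
def formGradL (α : Fin N → ℝ) (x : Fin N → E2) (s : Finset (Fin N)) : FormSpace α x s →L[ℂ] L2V :=
  WithLp.sndL 2 ℂ L2 L2V ∘L (formSpace α x s).subtypeL

theorem formIncl_formGradL_mem (v : FormSpace α x s) :
    (formIncl α x s v, formGradL α x s v) ∈ (minGraph α x s).topologicalClosure := v.2

theorem exists_formSpace {p : L2 × L2V} (hp : p ∈ (minGraph α x s).topologicalClosure) :
    ∃ v : FormSpace α x s, formIncl α x s v = p.1 ∧ formGradL α x s v = p.2 :=
  ⟨⟨WithLp.toLp 2 p, hp⟩, rfl, rfl⟩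

theorem formSpace_inner (v u : FormSpace α x s) :
    inner ℂ v u = inner ℂ (formIncl α x s v) (formIncl α x s u) +
      inner ℂ (formGradL α x s v) (formGradL α x s u) := rfl

/-- Closability again; it allows identities in the form space to be checked in `L²`. -/
theorem formIncl_injective : Function.Injective (formIncl α x s) := by
  rw [injective_iff_map_eq_zero]
  intro v hv
  have h1 := snd_eq_zero_of_mem_closure_minGraph _ (formIncl_formGradL_mem v) hv
  have h2 := norm_sq_of_graphNorm formSpace_inner v
  rw [hv, show formGradL α x s v = 0 from h1] at h2
  simpa using h2

/-- The solution operator `f ↦ (H - z)⁻¹ f` with values in the form domain. -/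
def formSolve (α : Fin N → ℝ) (x : Fin N → E2) (s : Finset (Fin N)) (z : ℂ) :
    L2 →L[ℂ] FormSpace α x s :=
  shiftedFormSolve (formIncl α x s) z

theorem mem_formGrad_domain (v : FormSpace α x s) : formIncl α x s v ∈ (formGrad α x s).domain :=
  ⟨_, formIncl_formGradL_mem v, rfl⟩

/-- `toLinearPMap` chooses a value over each point of the domain; closability leaves only one
choice. -/
theorem formGrad_formIncl (v : FormSpace α x s) (h : formIncl α x s v ∈ (formGrad α x s).domain) :
    formGrad α x s ⟨formIncl α x s v, h⟩ = formGradL α x s v := by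
  have h1 := Submodule.mem_graph_toLinearPMap
    (g := (minGraph α x s).topologicalClosure) snd_eq_zero_of_mem_closure_minGraph
    ⟨formIncl α x s v, h⟩
  have h2 := Submodule.sub_mem _ h1 (formIncl_formGradL_mem v)
  exact sub_eq_zero.1 (snd_eq_zero_of_mem_closure_minGraph _ h2 (sub_self _))

theorem exists_formIncl_eq (u : (formGrad α x s).domain) :
    ∃ v : FormSpace α x s, formIncl α x s v = u := by
  obtain ⟨p, hp, hpu⟩ := u.2
  obtain ⟨v, hv, -⟩ := exists_formSpace hp
  exact ⟨v, hv.trans hpu⟩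

theorem mem_friedrichsGraph_iff {p : L2 × L2} :
    p ∈ friedrichsGraph α x s ↔ ∃ u : FormSpace α x s, formIncl α x s u = p.1 ∧
      ∀ v : FormSpace α x s, inner ℂ (formGradL α x s v) (formGradL α x s u) =
        inner ℂ (formIncl α x s v) p.2 := by
  constructor
  · rintro ⟨u, hu, h⟩
    obtain ⟨u', hu'⟩ := exists_formIncl_eq u
    refine ⟨u', hu'.trans hu, fun v => ?_⟩
    have := h ⟨_, mem_formGrad_domain v⟩
    obtain rfl : u = ⟨_, mem_formGrad_domain u'⟩ := Subtype.ext hu'.symm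
    rwa [friedrichsForm, formGrad_formIncl, formGrad_formIncl] at this
  · rintro ⟨u, hu, h⟩
    refine ⟨⟨_, mem_formGrad_domain u⟩, hu, fun v => ?_⟩
    obtain ⟨v', hv'⟩ := exists_formIncl_eq v
    obtain rfl : v = ⟨_, mem_formGrad_domain v'⟩ := Subtype.ext hv'.symm
    rw [friedrichsForm, formGrad_formIncl, formGrad_formIncl]
    exact h v'

/-- The associated operator is single-valued because the form domain is dense. -/
theorem snd_eq_zero_of_mem_friedrichsGraph (p : L2 × L2) (hp : p ∈ friedrichsGraph α x s)
    (h0 : p.1 = 0) : p.2 = 0 := by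
  obtain ⟨u, hu, h⟩ := mem_friedrichsGraph_iff.1 hp
  have hu0 : u = 0 := formIncl_injective (by rw [hu, h0, map_zero])
  refine eq_zero_of_forall_inner_eq_zero (α := α) (x := x) (s := s) fun q hq => ?_
  obtain ⟨v, hv, -⟩ := exists_formSpace hq
  rw [← hv, ← h v, hu0, map_zero, inner_zero_right]

/-- The weak equation solved by `formSolve` is exactly membership of `(u, f + z u)` in the
Friedrichs graph. -/
theorem isResolvent_friedrichs {z : ℂ} (hz : z ∉ halfLine) :
    IsResolvent (friedrichs α x s) z (formIncl α x s ∘L formSolve α x s z) := by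
  constructor
  · intro f
    set u := formSolve α x s z f
    have hmem : (formIncl α x s u, f + z • formIncl α x s u) ∈ friedrichsGraph α x s := by
      refine mem_friedrichsGraph_iff.2 ⟨u, rfl, fun v => ?_⟩
      have h := inner_shiftedFormSolve formSpace_inner hz f v
      rw [inner_add_right, inner_smul_right, ← h]
      exact (sub_add_cancel _ _).symm
    have hd : formIncl α x s u ∈ (friedrichs α x s).domain := ⟨_, hmem, rfl⟩
    refine ⟨hd, ?_⟩
    have h1 := Submodule.mem_graph_toLinearPMap (g := friedrichsGraph α x s)
      snd_eq_zero_of_mem_friedrichsGraph ⟨_, hd⟩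
    have h2 := snd_eq_zero_of_mem_friedrichsGraph _ (Submodule.sub_mem _ h1 hmem) (sub_self _)
    have h3 := sub_eq_zero.1 h2
    exact sub_eq_iff_eq_add.2 h3
  · intro u
    obtain ⟨v, hv, h⟩ := mem_friedrichsGraph_iff.1 (Submodule.mem_graph_toLinearPMap
      (g := friedrichsGraph α x s) snd_eq_zero_of_mem_friedrichsGraph u)
    rw [ContinuousLinearMap.comp_apply, formSolve, shiftedFormSolve_eq formSpace_inner hz
      (u := v) fun w => ?_, hv]
    rw [inner_sub_right, inner_smul_right, h w, hv]
    rfl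

/-- Makes the choice in `resolventOp` immaterial. -/
theorem IsResolvent.eq {H : L2 →ₗ.[ℂ] L2} {z : ℂ} {R R' : L2 →L[ℂ] L2} (h : IsResolvent H z R)
    (h' : IsResolvent H z R') : R = R' := by
  ext1 f
  obtain ⟨hd, hf⟩ := h'.1 f
  conv_lhs => rw [← hf]
  exact h.2 ⟨_, hd⟩

theorem resolventOp_friedrichs {z : ℂ} (hz : z ∉ halfLine) :
    resolventOp (friedrichs α x s) z = formIncl α x s ∘L formSolve α x s z := by
  have h : InResolventSet (friedrichs α x s) z := ⟨_, isResolvent_friedrichs hz⟩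
  rw [resolventOp, dif_pos h]
  exact h.choose_spec.eq (isResolvent_friedrichs hz)

theorem singleGrad_formIncl (n : Option (Fin N)) (v : FormSpace α x n.toFinset) :
    singleGrad α x n (formIncl α x n.toFinset v) = formGradL α x n.toFinset v := by
  rw [singleGrad, dif_pos (mem_formGrad_domain v), formGrad_formIncl]

end FormSpace

end

/-! ### Cutoffs acting between form domains and their commutator with the forms. -/

section

variable {N : ℕ} {α : Fin N → ℝ} {x : Fin N → E2} {s s' : Finset (Fin N)}

section Cutoff

open ContinuousLinearMap

/-- `(-i∇ + S)² g`. -/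
def magLaplacian (S : E2 → E2) (g : E2 → ℂ) (y : E2) : ℂ :=
  ∑ j, magGrad S (fun y' => magGrad S g y' j) y j

theorem tsupport_magLaplacian_subset (S : E2 → E2) (g : E2 → ℂ) :
    tsupport (magLaplacian S g) ⊆ tsupport g := by
  refine closure_minimal (fun y hy => ?_) (isClosed_tsupport g)
  by_contra h
  refine hy (Finset.sum_eq_zero fun j _ => ?_)
  have h1 : y ∉ tsupport fun y' => magGrad S g y' j := fun h' =>
    h (tsupport_magGrad_subset S g (tsupport_component_subset _ j h'))
  rw [image_eq_zero_of_notMem_tsupport fun h' => h1 (tsupport_magGrad_subset S _ h')]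
  rfl

theorem contDiff_magGrad_component {S : E2 → E2} {g : E2 → ℂ}
    (hS : ∀ y ∈ tsupport g, ContDiffAt ℝ 1 S y) (hg : ContDiff ℝ 2 g) (j : Fin 2) :
    ContDiff ℝ 1 fun y => magGrad S g y j :=
  (contDiff_piLp 2).1 (contDiff_magGrad hS hg (by norm_num)) j

theorem continuous_magLaplacian {S : E2 → E2} {g : E2 → ℂ}
    (hS : ∀ y ∈ tsupport g, ContDiffAt ℝ 1 S y) (hg : ContDiff ℝ 2 g) :
    Continuous (magLaplacian S g) := by
  refine continuous_finsetSum _ fun j _ => ?_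
  have h : Continuous (magGrad S fun y' => magGrad S g y' j) :=
    (contDiff_magGrad (k := 0) (fun y hy => (hS y (tsupport_magGrad_subset S g
      (tsupport_component_subset _ j hy))).of_le (by simp))
      (contDiff_magGrad_component hS hg j) le_rfl).continuous
  exact (EuclideanSpace.proj (𝕜 := ℂ) j).continuous.comp h

/-- A bounded function `g` that cuts off the fluxes outside `s`, together with the bounds on
its derivatives needed for multiplication by `g` to act on form domains. -/
structure IsFluxCutoff (α : Fin N → ℝ) (x : Fin N → E2) (s : Finset (Fin N)) (g : E2 → ℂ) :
    Prop where
  contDiff : ContDiff ℝ 2 g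
  avoid : ∀ n, n ∉ s → x n ∉ tsupport g
  bdd : ∃ C, ∀ y, ‖g y‖ ≤ C
  bdd_grad : ∃ C, ∀ y, ‖magGrad (potential α x sᶜ) g y‖ ≤ C
  bdd_lap : ∃ C, ∀ y, ‖magLaplacian (potential α x sᶜ) g y‖ ≤ C

/-- Multiplication by `g` on `L²` together with its Leibniz rule. -/
def leibnizOp {g : E2 → ℂ} {β : E2 → EuclideanSpace ℂ (Fin 2)}
    (h₁ : IsBddField (scalarField ℂ g)) (h₂ : IsBddField (scalarField (EuclideanSpace ℂ (Fin 2)) g))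
    (h₃ : IsBddField (vectorField β)) : L2 × L2V →L[ℂ] L2 × L2V :=
  (fieldOp _ h₁ ∘L fst ℂ L2 L2V).prod
    (fieldOp _ h₂ ∘L snd ℂ L2 L2V + fieldOp _ h₃ ∘L fst ℂ L2 L2V)

/-- On test functions this is the Leibniz rule together with the `C¹` approximation; continuity
extends it to the closure. General `s`, `s'`, `B` cover both directions: adding fluxes with `g` and
removing them with its conjugate. -/
theorem leibnizOp_mem {g : E2 → ℂ} {β : E2 → EuclideanSpace ℂ (Fin 2)}
    (h₁ : IsBddField (scalarField ℂ g)) (h₂ : IsBddField (scalarField (EuclideanSpace ℂ (Fin 2)) g))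
    (h₃ : IsBddField (vectorField β)) (hg : ContDiff ℝ 1 g) {B : E2 → E2}
    (hβ : ∀ y, β y = magGrad B g y)
    (hB : ∀ y, potential α x s' y = potential α x s y + B y)
    (hs : ∀ n ∈ s', n ∉ s → x n ∉ tsupport g) {p : L2 × L2V}
    (hp : p ∈ (minGraph α x s).topologicalClosure) :
    leibnizOp h₁ h₂ h₃ p ∈ (minGraph α x s').topologicalClosure := by
  refine closure_minimal (fun p hp => ?_) ((Submodule.isClosed_topologicalClosure
    (minGraph α x s')).preimage (leibnizOp h₁ h₂ h₃).continuous) hp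
  obtain ⟨φ, hφ, h1, h2⟩ := hp
  have hgφ := hφ.isC1TestFunction.mul hg hs
  have heq : leibnizOp h₁ h₂ h₃ p = (hgφ.memLp.toLp _,
      hgφ.memLp_magGrad.toLp (magGrad (potential α x s') fun y => g y * φ y)) := by
    refine Prod.ext (Lp.ext ?_) (Lp.ext ?_)
    · filter_upwards [coeFn_fieldOp h₁ p.1, h1, hgφ.memLp.coeFn_toLp] with y a b c
      rw [c]
      refine a.trans ?_
      rw [b]
      rfl
    · filter_upwards [coeFn_fieldOp h₂ p.2, coeFn_fieldOp h₃ p.1, h1, h2,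
        (hgφ.memLp_magGrad (α := α)).coeFn_toLp,
        Lp.coeFn_add (fieldOp _ h₂ p.2) (fieldOp _ h₃ p.1)] with y a b c d e f
      rw [e, magGrad_mul (hφ.isC1TestFunction.1.differentiable (by simp) y)
        (hg.differentiable (by simp) y) (hB y), ← hβ, ← c, ← d]
      refine f.trans ?_
      rw [Pi.add_apply, a, b]
      rfl
  rw [Set.mem_preimage, heq]
  exact hgφ.mem_closure_minGraph

theorem exists_formSpace_map (L : L2 × L2V →L[ℂ] L2 × L2V)
    (hL : ∀ p ∈ (minGraph α x s).topologicalClosure, L p ∈ (minGraph α x s').topologicalClosure) :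
    ∃ K : FormSpace α x s →L[ℂ] FormSpace α x s', ∀ v,
      (formIncl α x s' (K v), formGradL α x s' (K v)) = L (formIncl α x s v, formGradL α x s v) := by
  refine ⟨((WithLp.prodContinuousLinearEquiv 2 ℂ L2 L2V).symm.toContinuousLinearMap ∘L L ∘L
    (formIncl α x s).prod (formGradL α x s)).codRestrict (formSpace α x s')
    fun v => hL _ (formIncl_formGradL_mem v), fun v => rfl⟩

namespace IsFluxCutoff

variable {g : E2 → ℂ}

theorem contDiffAt_potential (h : IsFluxCutoff α x s g) {k : WithTop ℕ∞} {y : E2}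
    (hy : y ∈ tsupport g) : ContDiffAt ℝ k (potential α x sᶜ) y :=
  AharonovBohm.contDiffAt_potential fun n hn h' =>
    h.avoid n (Finset.mem_compl.1 hn) (h' ▸ hy)

theorem continuous_magGrad (h : IsFluxCutoff α x s g) :
    Continuous (magGrad (potential α x sᶜ) g) :=
  (contDiff_magGrad (k := 1) (fun _ hy => h.contDiffAt_potential hy) h.contDiff
    (by norm_num)).continuous

theorem isBddField_scalar (h : IsFluxCutoff α x s g) (E : Type*) [NormedAddCommGroup E]
    [InnerProductSpace ℂ E] : IsBddField (scalarField E g) :=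
  isBddField_scalarField h.contDiff.continuous h.bdd.choose_spec

theorem isBddField_scalar_conj (h : IsFluxCutoff α x s g) (E : Type*) [NormedAddCommGroup E]
    [InnerProductSpace ℂ E] : IsBddField (scalarField E fun y => starRingEnd ℂ (g y)) :=
  isBddField_scalarField (C := h.bdd.choose) (continuous_conj.comp h.contDiff.continuous)
    fun y => by rw [RCLike.norm_conj]; exact h.bdd.choose_spec y

theorem isBddField_vector (h : IsFluxCutoff α x s g) :
    IsBddField (vectorField (magGrad (potential α x sᶜ) g)) :=
  isBddField_vectorField h.continuous_magGrad h.bdd_grad.choose_spec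

theorem isBddField_dot (h : IsFluxCutoff α x s g) :
    IsBddField (dotField (magGrad (potential α x sᶜ) g)) :=
  isBddField_dotField h.continuous_magGrad h.bdd_grad.choose_spec

theorem isBddField_vector_conj (h : IsFluxCutoff α x s g) :
    IsBddField (vectorField (magGrad (-potential α x sᶜ) fun y => starRingEnd ℂ (g y))) := by
  have he : ∀ y, magGrad (-potential α x sᶜ) (fun y => starRingEnd ℂ (g y)) y =
      WithLp.toLp 2 fun j => -starRingEnd ℂ (magGrad (potential α x sᶜ) g y j) := fun y => by
    ext j
    exact magGrad_neg_conj _ g y j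
  refine isBddField_vectorField (C := h.bdd_grad.choose) ?_ fun y => ?_
  · simp only [funext he]
    have hc := h.continuous_magGrad
    generalize magGrad (potential α x sᶜ) g = β at hc
    fun_prop
  · rw [he, EuclideanSpace.norm_eq]
    simp only [norm_neg, RCLike.norm_conj]
    rw [← EuclideanSpace.norm_eq]
    exact h.bdd_grad.choose_spec y

theorem isBddField_lap (h : IsFluxCutoff α x s g) :
    IsBddField (scalarField ℂ (magLaplacian (potential α x sᶜ) g)) :=
  isBddField_scalarField (continuous_magLaplacian (fun _ hy => h.contDiffAt_potential hy)
    h.contDiff) h.bdd_lap.choose_spec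

/-- Multiplication by the cutoff maps the form domain of the fluxes in `s` to that of all fluxes. -/
theorem exists_map (h : IsFluxCutoff α x s g) :
    ∃ K : FormSpace α x s →L[ℂ] FormSpace α x Finset.univ, ∀ v,
      formIncl α x _ (K v) = fieldOp _ (h.isBddField_scalar ℂ) (formIncl α x s v) ∧
      formGradL α x _ (K v) = fieldOp _ (h.isBddField_scalar _) (formGradL α x s v) +
        fieldOp _ h.isBddField_vector (formIncl α x s v) := by
  obtain ⟨K, hK⟩ := exists_formSpace_map (α := α) (x := x) (s := s) (s' := Finset.univ)
    (leibnizOp (h.isBddField_scalar ℂ) (h.isBddField_scalar _) h.isBddField_vector)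
    fun p hp => leibnizOp_mem _ _ _ (h.contDiff.of_le (by norm_num)) (fun y => rfl)
      (fun y => (potential_add_potential_compl y).symm) (fun n _ hn => h.avoid n hn) hp
  exact ⟨K, fun v => Prod.mk.inj (hK v)⟩

/-- Multiplication by the conjugate cutoff maps the form domain of all fluxes to that of the fluxes
in `s`. -/
theorem exists_map_conj (h : IsFluxCutoff α x s g) :
    ∃ M : FormSpace α x Finset.univ →L[ℂ] FormSpace α x s, ∀ v,
      formIncl α x _ (M v) = fieldOp _ (h.isBddField_scalar_conj ℂ) (formIncl α x _ v) ∧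
      formGradL α x _ (M v) = fieldOp _ (h.isBddField_scalar_conj _) (formGradL α x _ v) +
        fieldOp _ h.isBddField_vector_conj (formIncl α x _ v) := by
  obtain ⟨K, hK⟩ := exists_formSpace_map (α := α) (x := x) (s := Finset.univ) (s' := s)
    (leibnizOp (h.isBddField_scalar_conj ℂ) (h.isBddField_scalar_conj _) h.isBddField_vector_conj)
    fun p hp => leibnizOp_mem _ _ _ (conjCLE.contDiff.comp (h.contDiff.of_le (by norm_num)))
      (fun y => rfl) (fun y => by
        rw [← potential_add_potential_compl (s := s) y, Pi.neg_apply, add_neg_cancel_right])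
      (fun n _ hn => absurd (Finset.mem_univ n) hn) hp
  exact ⟨K, fun v => Prod.mk.inj (hK v)⟩

/-- The commutator of the cutoff with the forms. -/
def commutator (h : IsFluxCutoff α x s g) : FormSpace α x s →L[ℂ] L2 :=
  (2 : ℂ) • (fieldOp _ h.isBddField_dot ∘L formGradL α x s) +
    fieldOp _ h.isBddField_lap ∘L formIncl α x s

/-- With `β = (-i∇ + S) g`, this moves the gradient off `p` onto `β u`, splitting it as `β · D u +
((-i∇ + S)² g) u`. Hence the commutator takes values in `L²` and not merely in the dual of the form
domain. The weak form already covers every `p` in the closure, so only `q` is approximated. -/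
theorem inner_snd_vector_eq (h : IsFluxCutoff α x s g) {p q : L2 × L2V}
    (hp : p ∈ (minGraph α x Finset.univ).topologicalClosure)
    (hq : q ∈ (minGraph α x s).topologicalClosure) :
    inner ℂ p.2 (fieldOp _ h.isBddField_vector q.1) =
      inner ℂ p.1 (fieldOp _ h.isBddField_dot q.2 + fieldOp _ h.isBddField_lap q.1) := by
  have hclosed : IsClosed {q : L2 × L2V | inner ℂ p.2 (fieldOp _ h.isBddField_vector q.1) =
      inner ℂ p.1 (fieldOp _ h.isBddField_dot q.2 + fieldOp _ h.isBddField_lap q.1)} :=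
    isClosed_eq (by fun_prop) (by fun_prop)
  refine closure_minimal (fun q hq => ?_) hclosed hq
  obtain ⟨ψ, hψ, h1, h2⟩ := hq
  have hψ' := hψ.isC1TestFunction
  set β := magGrad (potential α x sᶜ) g
  have hβ : ContDiff ℝ 1 β := contDiff_magGrad (fun _ hy => h.contDiffAt_potential hy) h.contDiff
    (by norm_num)
  refine inner_snd_eq_inner_fst_of_mem_closure hp (G := fun y => ψ y • β y) ?_ ?_ ?_ ?_ ?_
  · exact hψ'.1.smul hβ
  · exact hψ'.2.1.smul_right
  · intro n _ hn
    by_cases hns : n ∈ s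
    · exact hψ'.2.2 n hns (tsupport_smul_subset_left ψ β hn)
    · exact h.avoid n hns (tsupport_magGrad_subset _ g (tsupport_smul_subset_right ψ β hn))
  · filter_upwards [coeFn_fieldOp h.isBddField_vector q.1, h1] with y a b
    rw [a, b]
    rfl
  · filter_upwards [coeFn_fieldOp h.isBddField_dot q.2, coeFn_fieldOp h.isBddField_lap q.1, h1, h2,
      Lp.coeFn_add (fieldOp _ h.isBddField_dot q.2) (fieldOp _ h.isBddField_lap q.1)] with y a b c d e
    rw [e, Pi.add_apply, a, b, c, d]
    have hj : ∀ j, magGrad (potential α x Finset.univ) (fun y => (ψ y • β y) j) y j =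
        β y j * magGrad (potential α x s) ψ y j +
          ψ y * magGrad (potential α x sᶜ) (fun y => β y j) y j := fun j => by
      have := congr($(magGrad_mul (C := potential α x Finset.univ) (A := potential α x s)
        (B := potential α x sᶜ) (f := ψ) (g := fun y => β y j) (y := y)
        (hψ'.1.differentiable (by simp) y)
        (((contDiff_piLp 2).1 hβ j).differentiable (by simp) y)
        (potential_add_potential_compl y).symm) j)
      simp only [PiLp.smul_apply, smul_eq_mul, mul_comm (ψ _)]
      simpa [mul_comm] using this
    simp only [hj, Finset.sum_add_distrib, ← Finset.mul_sum]
    simp [dotField, scalarField, magLaplacian, β, mul_comm]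

theorem inner_scalar_conj (h : IsFluxCutoff α x s g) {E : Type*} [NormedAddCommGroup E]
    [InnerProductSpace ℂ E] (a b : Lp E 2 (volume : Measure E2)) :
    inner ℂ (fieldOp _ (h.isBddField_scalar_conj E) a) b =
      inner ℂ a (fieldOp _ (h.isBddField_scalar E) b) :=
  inner_fieldOp_eq _ _ (fun y a b => by
    simp [scalarField, mul_comm]) a b

/-- This sign produces a second copy of `β · D u` in the commutator, whence the factor `2` there. -/
theorem inner_vector_conj (h : IsFluxCutoff α x s g) (a : L2) (b : L2V) :
    inner ℂ (fieldOp _ h.isBddField_vector_conj a) b =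
      -inner ℂ a (fieldOp _ h.isBddField_dot b) := by
  rw [L2.inner_def, L2.inner_def, ← integral_neg]
  refine integral_congr_ae ?_
  filter_upwards [coeFn_fieldOp h.isBddField_vector_conj a, coeFn_fieldOp h.isBddField_dot b]
    with y h1 h2
  rw [h1, h2]
  simp only [vectorField, dotField, toSpanSingleton_apply, PiLp.inner_apply, PiLp.smul_apply,
    magGrad_neg_conj]
  simp [Fin.sum_univ_two]
  ring

/-- The terms `g D u` cancel, and so do the `z`-terms, because `g` and its conjugate are adjoint;
what remains is `⟪Dv, β u⟫ + ⟪v, β · D u⟫`. -/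
theorem comp_eq (h : IsFluxCutoff α x s g) {z : ℂ}
    {K : FormSpace α x s →L[ℂ] FormSpace α x Finset.univ}
    (hK : ∀ v, formIncl α x _ (K v) = fieldOp _ (h.isBddField_scalar ℂ) (formIncl α x s v) ∧
      formGradL α x _ (K v) = fieldOp _ (h.isBddField_scalar _) (formGradL α x s v) +
        fieldOp _ h.isBddField_vector (formIncl α x s v))
    {M : FormSpace α x Finset.univ →L[ℂ] FormSpace α x s}
    (hM : ∀ v, formIncl α x _ (M v) = fieldOp _ (h.isBddField_scalar_conj ℂ) (formIncl α x _ v) ∧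
      formGradL α x _ (M v) = fieldOp _ (h.isBddField_scalar_conj _) (formGradL α x _ v) +
        fieldOp _ h.isBddField_vector_conj (formIncl α x _ v)) :
    shiftedForm (formIncl α x Finset.univ) z ∘L K =
      adjoint M ∘L shiftedForm (formIncl α x s) z + adjoint (formIncl α x _) ∘L h.commutator := by
  refine shiftedForm_comp_eq formSpace_inner formSpace_inner fun v u => ?_
  have hw := (h.inner_snd_vector_eq (formIncl_formGradL_mem v) (formIncl_formGradL_mem u)).trans
    (inner_add_right _ _ _)
  have hp : inner ℂ (formIncl α x _ v) (h.commutator u) =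
      2 * inner ℂ (formIncl α x _ v) (fieldOp _ h.isBddField_dot (formGradL α x s u)) +
      inner ℂ (formIncl α x _ v) (fieldOp _ h.isBddField_lap (formIncl α x s u)) := by
    rw [← inner_smul_right, ← inner_add_right]
    rfl
  have h1 : inner ℂ (formGradL α x _ v) (formGradL α x _ (K u)) =
      inner ℂ (formGradL α x _ v) (fieldOp _ (h.isBddField_scalar _) (formGradL α x s u)) +
      inner ℂ (formGradL α x _ v) (fieldOp _ h.isBddField_vector (formIncl α x s u)) := by
    rw [(hK u).2, inner_add_right]
  have h2 : inner ℂ (formGradL α x _ (M v)) (formGradL α x _ u) =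
      inner ℂ (formGradL α x _ v) (fieldOp _ (h.isBddField_scalar _) (formGradL α x s u)) -
      inner ℂ (formIncl α x _ v) (fieldOp _ h.isBddField_dot (formGradL α x s u)) := by
    rw [(hM v).2, inner_add_left, h.inner_scalar_conj, h.inner_vector_conj, sub_eq_add_neg]
  have h3 : inner ℂ (formIncl α x _ (M v)) (formIncl α x _ u) =
      inner ℂ (formIncl α x _ v) (formIncl α x _ (K u)) := by
    rw [(hK u).1, (hM v).1, h.inner_scalar_conj]
  linear_combination h1 - h2 - hp + hw + z * h3

end IsFluxCutoff

end Cutoff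

end

/-! ### The gauge phase and the coefficients of `P n`. -/

section

variable {N : ℕ} {α : Fin N → ℝ} {x : Fin N → E2} {s s' : Finset (Fin N)}

section GaugePhase

variable {x₀ a₀ : E2} {n : Option (Fin N)}

theorem phase_ne_zero (y : E2) : phase α x x₀ a₀ n y ≠ 0 := exp_ne_zero _

theorem norm_phase (y : E2) : ‖phase α x x₀ a₀ n y‖ = 1 := by
  rw [phase, mul_comm, norm_exp_ofReal_mul_I]

theorem conj_phase (y : E2) : starRingEnd ℂ (phase α x x₀ a₀ n y) = (phase α x x₀ a₀ n y)⁻¹ := by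
  rw [phase, ← exp_conj, ← Complex.exp_neg, map_mul, conj_I, conj_ofReal, neg_mul]

theorem contDiff_phase_inv {k : WithTop ℕ∞} : ContDiff ℝ k fun y => (phase α x x₀ a₀ n y)⁻¹ := by
  refine ContDiff.inv (ContDiff.cexp ?_) phase_ne_zero
  exact contDiff_const.mul (ofRealCLM.contDiff.comp
    (contDiff_const.inner ℝ (contDiff_id.sub contDiff_const)))

theorem partialDeriv_phase_inv (j : Fin 2) (y : E2) :
    partialDeriv j (fun y => (phase α x x₀ a₀ n y)⁻¹) y =
      -I * (gaugeVec α x a₀ n j : ℂ) * (phase α x x₀ a₀ n y)⁻¹ := by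
  have h1 : HasFDerivAt (fun y => -(I * ((inner ℝ (gaugeVec α x a₀ n)
      (y - basePoint x x₀ n) : ℝ) : ℂ))) (-(I • (ofRealCLM ∘L innerSL ℝ (gaugeVec α x a₀ n)))) y := by
    have h2 : HasFDerivAt (fun y => innerSL ℝ (gaugeVec α x a₀ n) (y - basePoint x x₀ n))
        (innerSL ℝ (gaugeVec α x a₀ n)) y :=
      (innerSL ℝ (gaugeVec α x a₀ n)).hasFDerivAt.comp y ((hasFDerivAt_id y).sub_const _)
    exact ((ofRealCLM.hasFDerivAt.comp y h2).const_mul I).neg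
  simp only [phase, ← Complex.exp_neg]
  rw [partialDeriv, h1.cexp.fderiv]
  simp [EuclideanSpace.inner_single_right]
  ring

/-- Gauge covariance: `-i∇ + a n` annihilates `e^{-iθ n}`, so the phase passes through and shifts
the potential by a constant. -/
theorem magGrad_phase_inv_mul {S : E2 → E2} {f : E2 → ℂ} {y : E2} (hf : DifferentiableAt ℝ f y) :
    magGrad S (fun y => (phase α x x₀ a₀ n y)⁻¹ * f y) y =
      (phase α x x₀ a₀ n y)⁻¹ • magGrad (fun y => S y - gaugeVec α x a₀ n) f y := by
  rw [magGrad_mul (A := fun y => S y - gaugeVec α x a₀ n) (B := fun _ => gaugeVec α x a₀ n) hf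
    (contDiff_phase_inv.differentiable one_ne_zero y) (by simp), add_eq_left, smul_eq_zero]
  right
  ext j
  rw [magGrad_apply, partialDeriv_phase_inv]
  change _ = (0 : ℂ)
  linear_combination (-(gaugeVec α x a₀ n j : ℂ) * -(phase α x x₀ a₀ n y)⁻¹) * I_mul_I

end GaugePhase

section RealFunctions

variable {ξ : E2 → ℝ}

theorem partialDeriv_ofReal {f : E2 → ℝ} {y : E2} (hf : DifferentiableAt ℝ f y) (j : Fin 2) :
    partialDeriv j (fun y => (f y : ℂ)) y = (fderiv ℝ f y (EuclideanSpace.single j 1) : ℝ) := by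
  have h := ofRealCLM.hasFDerivAt.comp y hf.hasFDerivAt
  exact congr($(HasFDerivAt.fderiv h) (EuclideanSpace.single j 1))

theorem gradient_component (f : E2 → ℝ) (y : E2) (j : Fin 2) :
    gradient f y j = fderiv ℝ f y (EuclideanSpace.single j 1) := by
  rw [gradient, ← InnerProductSpace.toDual_symm_apply, EuclideanSpace.inner_single_right]
  simp

theorem laplacian_eq_sum_fderiv (hξ : ContDiff ℝ 2 ξ) (y : E2) :
    Laplacian.laplacian ξ y = ∑ j : Fin 2, fderiv ℝ (fun y => gradient ξ y j) y
      (EuclideanSpace.single j 1) := by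
  rw [congr($(InnerProductSpace.laplacian_eq_iteratedFDeriv_orthonormalBasis ξ
    (EuclideanSpace.basisFun (Fin 2) ℝ)) y)]
  refine Finset.sum_congr rfl fun j _ => ?_
  have hd : DifferentiableAt ℝ (fderiv ℝ ξ) y :=
    (hξ.fderiv_right (m := 1) (by norm_num)).differentiable one_ne_zero y
  simp only [gradient_component]
  rw [iteratedFDeriv_two_apply, fderiv_clm_apply hd (differentiableAt_const _)]
  simp

theorem tsupport_ofReal (ξ : E2 → ℝ) : tsupport (fun y => (ξ y : ℂ)) = tsupport ξ := by
  have : Function.support (fun y => (ξ y : ℂ)) = Function.support ξ := by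
    ext y
    simp
  rw [tsupport, this, tsupport]

theorem magGrad_ofReal {S : E2 → E2} {y : E2} (hξ : DifferentiableAt ℝ ξ y) (j : Fin 2) :
    magGrad S (fun y => (ξ y : ℂ)) y j = ((S y j * ξ y : ℝ) : ℂ) - I * (gradient ξ y j : ℝ) := by
  rw [magGrad_apply, partialDeriv_ofReal hξ, gradient_component]
  push_cast
  ring

/-- Expanding the square leaves the extra term `-i (div S) ξ`, which vanishes. Off the support of
`ξ`, where `S` may be singular, both sides are zero. -/
theorem magLaplacian_ofReal {S : E2 → E2} (hξ : ContDiff ℝ 2 ξ)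
    (hS : ∀ y ∈ tsupport ξ, ContDiffAt ℝ 1 S y)
    (hdiv : ∀ y ∈ tsupport ξ,
      ∑ j : Fin 2, fderiv ℝ (fun y' => S y' j) y (EuclideanSpace.single j 1) = 0) (y : E2) :
    magLaplacian S (fun y => (ξ y : ℂ)) y = ((‖S y‖ ^ 2 * ξ y : ℝ) : ℂ)
      + 2 * ∑ j : Fin 2, (S y j : ℂ) * (-I * (gradient ξ y j : ℝ))
      - (Laplacian.laplacian ξ y : ℝ) := by
  by_cases hy : y ∈ tsupport ξ
  · have hξd : Differentiable ℝ ξ := hξ.differentiable (by norm_num)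
    have hgd : ∀ j, DifferentiableAt ℝ (fun y => gradient ξ y j) y := fun j => by
      simp only [gradient_component]
      exact ((hξ.fderiv_right (m := 1) (by norm_num)).clm_apply contDiff_const).differentiable
        one_ne_zero y
    have hSd : ∀ j, DifferentiableAt ℝ (fun y => S y j) y := fun j =>
      ((contDiffAt_piLp 2).1 (hS y hy) j).differentiableAt one_ne_zero
    have hj : ∀ j, magGrad S (fun y' => magGrad S (fun y => (ξ y : ℂ)) y' j) y j =
        -I * (fderiv ℝ (fun y' => S y' j) y (EuclideanSpace.single j 1) : ℝ) * ξ y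
        + 2 * ((S y j : ℂ) * (-I * (gradient ξ y j : ℝ))) + (S y j : ℂ) ^ 2 * ξ y
        - (fderiv ℝ (fun y => gradient ξ y j) y (EuclideanSpace.single j 1) : ℝ) := fun j => by
      have h1 : (fun y' => magGrad S (fun y => (ξ y : ℂ)) y' j) =
          fun y => ((S y j * ξ y : ℝ) : ℂ) + (-I) * ((gradient ξ y j : ℝ) : ℂ) := by
        ext y'
        rw [magGrad_ofReal (hξd y')]
        ring
      have h2 : DifferentiableAt ℝ (fun y => ((S y j * ξ y : ℝ) : ℂ)) y :=
        ofRealCLM.differentiableAt.comp y ((hSd j).mul (hξd y))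
      have h3 : DifferentiableAt ℝ (fun y => ((gradient ξ y j : ℝ) : ℂ)) y :=
        ofRealCLM.differentiableAt.comp y (hgd j)
      have h4 : partialDeriv j
          (fun y => ((S y j * ξ y : ℝ) : ℂ) + (-I) * ((gradient ξ y j : ℝ) : ℂ)) y =
          partialDeriv j (fun y => ((S y j * ξ y : ℝ) : ℂ)) y
            + (-I) * partialDeriv j (fun y => ((gradient ξ y j : ℝ) : ℂ)) y := by
        simp only [partialDeriv]
        rw [fderiv_fun_add h2 (h3.const_mul _), fderiv_const_mul h3]
        rfl
      rw [h1, magGrad_apply, h4, partialDeriv_ofReal ((hSd j).fun_mul (hξd y)),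
        partialDeriv_ofReal (hgd j), fderiv_fun_mul (hSd j) (hξd y), _root_.add_apply,
        _root_.smul_apply, _root_.smul_apply, ← gradient_component]
      push_cast [smul_eq_mul]
      linear_combination ((fderiv ℝ (fun y => gradient ξ y j) y
        (EuclideanSpace.single j 1) : ℝ) : ℂ) * I_mul_I
    have hdiv' : ((∑ j : Fin 2, fderiv ℝ (fun y' => S y' j) y (EuclideanSpace.single j 1) : ℝ) : ℂ)
        = 0 := by rw [hdiv y hy, ofReal_zero]
    rw [magLaplacian, laplacian_eq_sum_fderiv hξ, EuclideanSpace.norm_sq_eq]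
    simp only [hj, Fin.sum_univ_two, Real.norm_eq_abs, sq_abs] at hdiv' ⊢
    push_cast at hdiv' ⊢
    linear_combination (-I * ξ y) * hdiv'
  · have h1 : magLaplacian S (fun y => (ξ y : ℂ)) y = 0 :=
      image_eq_zero_of_notMem_tsupport fun h => by
        have := tsupport_magLaplacian_subset S _ h
        rw [tsupport_ofReal] at this
        exact hy this
    have h2 : ∀ j, gradient ξ y j = 0 := fun j => by
      rw [gradient_component, image_eq_zero_of_notMem_tsupport
        fun h => hy (tsupport_fderiv_subset ℝ h)]
      rfl
    have h3 : Laplacian.laplacian ξ y = 0 := by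
      have := (InnerProductSpace.laplacian_congr_nhds
        (notMem_tsupport_iff_eventuallyEq.1 hy)).eq_of_nhds
      rw [this]
      exact congr($(InnerProductSpace.laplacian_const (c := (0 : ℝ))) y)
    simp [h1, h2, h3, image_eq_zero_of_notMem_tsupport hy]

end RealFunctions

end

/-! ### The flux partition provides admissible cutoffs. -/

section

variable {N : ℕ} {α : Fin N → ℝ} {x : Fin N → E2} {r : ℝ} {ξ : Option (Fin N) → E2 → ℝ}

theorem norm_le_of_forall_component_le {v : EuclideanSpace ℂ (Fin 2)} {C : ℝ}
    (h : ∀ j, ‖v j‖ ≤ C) : ‖v‖ ≤ 2 * C := by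
  conv_lhs => rw [← (EuclideanSpace.basisFun (Fin 2) ℂ).sum_repr v]
  refine (norm_sum_le _ _).trans ?_
  rw [Fin.sum_univ_two]
  simp only [norm_smul, OrthonormalBasis.norm_eq_one, mul_one, EuclideanSpace.basisFun_repr]
  linarith [h 0, h 1]

namespace IsFluxPartition

theorem norm_le_one (hξ : IsFluxPartition x r ξ) (n : Option (Fin N)) (y : E2) : ‖ξ n y‖ ≤ 1 := by
  rw [Real.norm_of_nonneg (hξ.mem_Icc n y).1]
  exact (hξ.mem_Icc n y).2

theorem eq_zero_of_eq_one (hξ : IsFluxPartition x r ξ) {m n : Option (Fin N)} (hmn : m ≠ n) {y : E2}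
    (h : ξ m y = 1) :
    ξ n y = 0 := by
  have h1 : ∑ k ∈ {m, n}, ξ k y ^ 2 ≤ ∑ k, ξ k y ^ 2 :=
    Finset.sum_le_sum_of_subset_of_nonneg (Finset.subset_univ _) fun _ _ _ => sq_nonneg _
  rw [hξ.sum_sq, Finset.sum_pair hmn, h] at h1
  have : ξ n y ^ 2 = 0 := le_antisymm (by linarith) (sq_nonneg _)
  simpa using this

theorem none_eq_one (hξ : IsFluxPartition x r ξ) {y : E2} (h : ∀ n : Fin N, ξ (some n) y = 0) :
    ξ none y = 1 := by
  have h1 := hξ.sum_sq y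
  rw [Fintype.sum_option] at h1
  simp only [h, ne_eq, OfNat.ofNat_ne_zero, not_false_eq_true, zero_pow, Finset.sum_const_zero,
    add_zero] at h1
  nlinarith [(hξ.mem_Icc none y).1, (hξ.mem_Icc none y).2]

theorem hasCompactSupport_some (hξ : IsFluxPartition x r ξ) (n : Fin N) : HasCompactSupport
    (ξ (some n)) :=
  (isCompact_closedBall (x n) r).of_isClosed_subset (isClosed_tsupport _)
    ((hξ.tsupport_subset n).trans Metric.ball_subset_closedBall)

/-- Although `ξ none` lacks compact support, it is identically `1` off the compact union of the
other supports. -/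
theorem hasCompactSupport_fderiv (hξ : IsFluxPartition x r ξ) (n : Option (Fin N)) :
    HasCompactSupport (fderiv ℝ (ξ n)) := by
  cases n with
  | some n => exact (hξ.hasCompactSupport_some n).fderiv ℝ
  | none =>
    have hK : IsCompact (⋃ n : Fin N, tsupport (ξ (some n))) :=
      isCompact_iUnion fun n => hξ.hasCompactSupport_some n
    refine HasCompactSupport.of_support_subset_isCompact hK fun y hy => ?_
    by_contra h
    refine hy ?_
    have h1 : ξ none =ᶠ[nhds y] fun _ => 1 := by
      filter_upwards [hK.isClosed.isOpen_compl.mem_nhds h] with y' hy'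
      refine hξ.none_eq_one fun n => ?_
      exact image_eq_zero_of_notMem_tsupport fun h' => hy' (Set.mem_iUnion.2 ⟨n, h'⟩)
    rw [h1.fderiv_eq, fderiv_fun_const]
    rfl

theorem exists_gradient_bound (hξ : IsFluxPartition x r ξ) (n : Option (Fin N)) : ∃ C, ∀ y j,
    ‖gradient (ξ n) y j‖ ≤ C := by
  obtain ⟨C, hC⟩ := ((hξ.contDiff n).continuous_fderiv (by norm_num)).bounded_above_of_compact_support
    (hξ.hasCompactSupport_fderiv n)
  refine ⟨C, fun y j => ?_⟩
  rw [gradient_component]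
  exact ((fderiv ℝ (ξ n) y).le_opNorm _).trans (by simpa using hC y)

theorem exists_laplacian_bound (hξ : IsFluxPartition x r ξ) (n : Option (Fin N)) :
    ∃ C, ∀ y, ‖Laplacian.laplacian (ξ n) y‖ ≤ C := by
  have hc : ContDiff ℝ 1 (fderiv ℝ (ξ n)) := (hξ.contDiff n).fderiv_right (by norm_num)
  obtain ⟨C, hC⟩ := (hc.continuous_fderiv one_ne_zero).bounded_above_of_compact_support
    ((hξ.hasCompactSupport_fderiv n).fderiv ℝ)
  refine ⟨2 * C, fun y => ?_⟩
  rw [congr($(InnerProductSpace.laplacian_eq_iteratedFDeriv_orthonormalBasis (ξ n)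
    (EuclideanSpace.basisFun (Fin 2) ℝ)) y)]
  have h : ∀ v : E2, ‖v‖ = 1 → ‖fderiv ℝ (fderiv ℝ (ξ n)) y v v‖ ≤ C := fun v hv => by
    refine (ContinuousLinearMap.le_opNorm₂ _ _ _).trans ?_
    simpa [hv] using hC y
  simp only [iteratedFDeriv_two_apply, Fin.sum_univ_two]
  refine (norm_add_le _ _).trans ?_
  have h0 := h _ ((EuclideanSpace.basisFun (Fin 2) ℝ).norm_eq_one 0)
  have h1 := h _ ((EuclideanSpace.basisFun (Fin 2) ℝ).norm_eq_one 1)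
  simp only [Matrix.cons_val_zero, Matrix.cons_val_one] at *
  linarith

/-- Since the squares sum to `1`, `ξ none` vanishes wherever `ξ (some m) = 1`. -/
theorem half_le_norm_sub (hξ : IsFluxPartition x r ξ) {y : E2} (hy : y ∈ tsupport (ξ none))
    (m : Fin N) :
    r / 2 ≤ ‖y - x m‖ := by
  have h : tsupport (ξ none) ⊆ (Metric.ball (x m) (r / 2))ᶜ := by
    refine closure_minimal (fun y hy h => hy ?_) Metric.isOpen_ball.isClosed_compl
    exact hξ.eq_zero_of_eq_one (by simp) (hξ.eq_one m y h)
  have := h hy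
  rwa [Set.mem_compl_iff, Metric.mem_ball, not_lt, dist_eq_norm] at this

theorem notMem_tsupport (hξ : IsFluxPartition x r ξ) (hr : 0 < r)
    (hx : ∀ m n, m ≠ n → r < dist (x m) (x n) / 2)
    (n : Option (Fin N)) (m : Fin N) (hm : m ∉ n.toFinset) : x m ∉ tsupport (ξ n) := by
  intro h
  cases n with
  | none =>
    have h1 := hξ.half_le_norm_sub h m
    rw [sub_self, norm_zero] at h1
    linarith
  | some n =>
    have hmn : m ≠ n := by simpa using hm
    have h1 := Metric.mem_ball.1 (hξ.tsupport_subset n h)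
    linarith [hx m n hmn]

theorem exists_regPart_bound (hξ : IsFluxPartition x r ξ) (hr : 0 < r)
    (hx : ∀ m n, m ≠ n → r < dist (x m) (x n) / 2)
    (n : Option (Fin N)) : ∃ C, ∀ y ∈ tsupport (ξ n), ‖regPart α x n y‖ ≤ C := by
  cases n with
  | none => exact ⟨_, fun y hy => norm_potential_le (half_pos hr) fun m _ =>
      hξ.half_le_norm_sub hy m⟩
  | some n =>
    refine (hξ.hasCompactSupport_some n).isCompact.exists_bound_of_continuousOn fun y hy => ?_
    refine (contDiffAt_potential (k := 0) fun m hm h => ?_).continuousAt.continuousWithinAt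
    exact hξ.notMem_tsupport hr hx (some n) m (by simpa using hm) (h ▸ hy)

theorem magGrad_cutoff (hξ : IsFluxPartition x r ξ) {x₀ a₀ : E2} (n : Option (Fin N)) (y : E2)
    (j : Fin 2) :
    magGrad (regPart α x n) (fun y => (phase α x x₀ a₀ n y)⁻¹ * (ξ n y : ℂ)) y j =
      (phase α x x₀ a₀ n y)⁻¹ *
        (((regPartSub α x a₀ n y j * ξ n y : ℝ) : ℂ) - I * (gradient (ξ n) y j : ℝ)) := by
  have hd : Differentiable ℝ (ξ n) := (hξ.contDiff n).differentiable (by norm_num)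
  have hdc : DifferentiableAt ℝ (fun y => (ξ n y : ℂ)) y := ofRealCLM.differentiableAt.comp y (hd y)
  rw [magGrad_phase_inv_mul hdc, PiLp.smul_apply,
    magGrad_ofReal (hd y)]
  rfl

/-- Gauge covariance is used once for each of the two gradients; subtracting a constant keeps the
potential divergence free. -/
theorem magLaplacian_cutoff (hξ : IsFluxPartition x r ξ) (hr : 0 < r)
    (hx : ∀ m n, m ≠ n → r < dist (x m) (x n) / 2)
    {x₀ a₀ : E2} (n : Option (Fin N)) (y : E2) :
    magLaplacian (regPart α x n) (fun y => (phase α x x₀ a₀ n y)⁻¹ * (ξ n y : ℂ)) y =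
      (phase α x x₀ a₀ n y)⁻¹ * (((‖regPartSub α x a₀ n y‖ ^ 2 * ξ n y : ℝ) : ℂ)
      + 2 * ∑ j : Fin 2, (regPartSub α x a₀ n y j : ℂ) * (-I * (gradient (ξ n) y j : ℝ))
      - (Laplacian.laplacian (ξ n) y : ℝ)) := by
  have hd : Differentiable ℝ (ξ n) := (hξ.contDiff n).differentiable (by norm_num)
  have hcd : ContDiff ℝ 2 fun y => (ξ n y : ℂ) := ofRealCLM.contDiff.comp (hξ.contDiff n)
  have havoid : ∀ y ∈ tsupport (ξ n), ∀ m ∈ (n.toFinset)ᶜ, y ≠ x m := fun y hy m hm h =>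
    hξ.notMem_tsupport hr hx n m (by simpa using hm) (h ▸ hy)
  have hS : ∀ y ∈ tsupport (ξ n), ContDiffAt ℝ 1 (regPartSub α x a₀ n) y := fun y hy =>
    (contDiffAt_potential (havoid y hy)).sub contDiffAt_const
  have hdiv : ∀ y ∈ tsupport (ξ n), ∑ j : Fin 2,
      fderiv ℝ (fun y' => regPartSub α x a₀ n y' j) y (EuclideanSpace.single j 1) = 0 :=
    fun y hy => by
      simp only [regPartSub, PiLp.sub_apply, fderiv_sub_const]
      exact div_potential (havoid y hy)
  rw [← magLaplacian_ofReal (hξ.contDiff n) hS hdiv, magLaplacian, magLaplacian, Finset.mul_sum]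
  refine Finset.sum_congr rfl fun j _ => ?_
  have h1 : (fun y' => magGrad (regPart α x n)
      (fun y => (phase α x x₀ a₀ n y)⁻¹ * (ξ n y : ℂ)) y' j) = fun y' =>
      (phase α x x₀ a₀ n y')⁻¹ * magGrad (regPartSub α x a₀ n) (fun y => (ξ n y : ℂ)) y' j := by
    ext y'
    rw [hξ.magGrad_cutoff, magGrad_ofReal (hd y')]
  have h2 : ContDiff ℝ 1 fun y' => magGrad (regPartSub α x a₀ n) (fun y => (ξ n y : ℂ)) y' j :=
    contDiff_magGrad_component (fun y hy => hS y (by rwa [tsupport_ofReal] at hy)) hcd j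
  rw [h1, magGrad_phase_inv_mul (h2.differentiable one_ne_zero y)]
  rfl

theorem isFluxCutoff (hξ : IsFluxPartition x r ξ) (hr : 0 < r)
    (hx : ∀ m n, m ≠ n → r < dist (x m) (x n) / 2) (x₀ a₀ : E2)
    (n : Option (Fin N)) :
    IsFluxCutoff α x n.toFinset fun y => (phase α x x₀ a₀ n y)⁻¹ * (ξ n y : ℂ) := by
  obtain ⟨C₁, hC₁⟩ := hξ.exists_gradient_bound n
  obtain ⟨C₂, hC₂⟩ := hξ.exists_laplacian_bound n
  obtain ⟨C₃, hC₃⟩ := hξ.exists_regPart_bound (α := α) hr hx n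
  set C := |C₃| + ‖gaugeVec α x a₀ n‖
  have hC₁' : 0 ≤ C₁ := (norm_nonneg _).trans (hC₁ 0 0)
  have hS : ∀ y ∈ tsupport (ξ n), ‖regPartSub α x a₀ n y‖ ≤ C := fun y hy =>
    (norm_sub_le _ _).trans (add_le_add_left ((hC₃ y hy).trans (le_abs_self _)) _)
  have hC : 0 ≤ C := by positivity
  have hsub : tsupport (fun y => (phase α x x₀ a₀ n y)⁻¹ * (ξ n y : ℂ)) ⊆ tsupport (ξ n) := by
    rw [← tsupport_ofReal (ξ n)]
    exact tsupport_mul_subset_right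
  have hout : ∀ y, y ∉ tsupport (ξ n) →
      y ∉ tsupport fun y => (phase α x x₀ a₀ n y)⁻¹ * (ξ n y : ℂ) := fun y hy h => hy (hsub h)
  have hSj : ∀ y ∈ tsupport (ξ n), ∀ j, ‖regPartSub α x a₀ n y j‖ ≤ C := fun y hy j =>
    (PiLp.norm_apply_le _ _).trans (hS y hy)
  -- On the support of `ξ n`, `C` bounds the shifted regular part, `C₁` the components of the
  -- gradient and `C₂` the Laplacian; a phase has modulus one.
  refine ⟨contDiff_phase_inv.mul (ofRealCLM.contDiff.comp (hξ.contDiff n)),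
    fun m hm h => hξ.notMem_tsupport hr hx n m hm (hsub h), ⟨1, fun y => ?_⟩,
    ⟨2 * (C + C₁), fun y => ?_⟩, ⟨C ^ 2 + 2 * (2 * (C * C₁)) + C₂, fun y => ?_⟩⟩
  · rw [norm_mul, norm_inv, norm_phase, inv_one, one_mul, norm_real]
    exact hξ.norm_le_one n y
  · refine norm_le_of_forall_component_le fun j => ?_
    by_cases hy : y ∈ tsupport (ξ n)
    · refine (congr(‖$(hξ.magGrad_cutoff n y j)‖)).trans_le ?_
      rw [norm_mul, norm_inv, norm_phase, inv_one, one_mul]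
      refine (norm_sub_le _ _).trans (add_le_add ?_ ?_)
      · rw [norm_real, norm_mul]
        exact (mul_le_of_le_one_right (norm_nonneg _) (hξ.norm_le_one n y)).trans (hSj y hy j)
      · rw [norm_mul, norm_I, one_mul, norm_real]
        exact hC₁ y j
    · rw [image_eq_zero_of_notMem_tsupport fun h => hout y hy (tsupport_magGrad_subset _ _ h)]
      simp only [PiLp.zero_apply, norm_zero]
      positivity
  · have hC₂' : 0 ≤ C₂ := (norm_nonneg _).trans (hC₂ 0)
    by_cases hy : y ∈ tsupport (ξ n)
    · refine (congr(‖$(hξ.magLaplacian_cutoff hr hx n y)‖)).trans_le ?_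
      rw [norm_mul, norm_inv, norm_phase, inv_one, one_mul]
      refine (norm_sub_le _ _).trans (add_le_add ((norm_add_le _ _).trans (add_le_add ?_ ?_)) ?_)
      · rw [norm_real, norm_mul, norm_pow, norm_norm]
        exact (mul_le_of_le_one_right (by positivity) (hξ.norm_le_one n y)).trans
          (by gcongr; exact hS y hy)
      · rw [norm_mul, Fin.sum_univ_two]
        have h : ∀ j, ‖(regPartSub α x a₀ n y j : ℂ) * (-I * (gradient (ξ n) y j : ℝ))‖ ≤ C * C₁ :=
          fun j => by
            rw [norm_mul, norm_mul, norm_neg, norm_I, one_mul, norm_real, norm_real]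
            exact mul_le_mul (hSj y hy j) (hC₁ y j) (norm_nonneg _) hC
        have h2 := norm_add_le ((regPartSub α x a₀ n y 0 : ℂ) * (-I * (gradient (ξ n) y 0 : ℝ)))
          ((regPartSub α x a₀ n y 1 : ℂ) * (-I * (gradient (ξ n) y 1 : ℝ)))
        have h0 := h 0
        have h1 := h 1
        rw [RCLike.norm_ofNat]
        linarith
      · rw [norm_real]
        exact hC₂ y
    · rw [image_eq_zero_of_notMem_tsupport fun h => hout y hy (tsupport_magLaplacian_subset _ _ h),
        norm_zero]
      positivity

end IsFluxPartition

end

/-! ### Assembly: resolvent formula, norm estimate and Neumann series. -/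

section

variable {N : ℕ} {α : Fin N → ℝ} {x : Fin N → E2} {r : ℝ} {ξ : Option (Fin N) → E2 → ℝ}

section Localization

open ContinuousLinearMap

variable {g : Option (Fin N) → E2 → ℂ}

/-- The sum `∑ n, p n ∘ (H n - z)⁻¹ ∘ conj (g n)` over all cutoffs, with `p n` the commutator of the
cutoff `g n` with the forms. -/
def commutatorSum (h : ∀ n : Option (Fin N), IsFluxCutoff α x n.toFinset (g n)) (z : ℂ) :
    L2 →L[ℂ] L2 :=
  ∑ n, (h n).commutator ∘L formSolve α x n.toFinset z ∘L
    fieldOp _ ((h n).isBddField_scalar_conj ℂ)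

/-- The adjoint of `e K = g e_s`. It turns `(B n)⁻¹ (K n)* e*` into the local solution operator
applied after multiplication by the conjugate cutoff. -/
theorem adjoint_cutoff {s : Finset (Fin N)} {g : E2 → ℂ} (h : IsFluxCutoff α x s g)
    {K : FormSpace α x s →L[ℂ] FormSpace α x Finset.univ}
    (hK : ∀ v, formIncl α x _ (K v) = fieldOp _ (h.isBddField_scalar ℂ) (formIncl α x s v)) (f : L2) :
    adjoint K (adjoint (formIncl α x _) f) =
      adjoint (formIncl α x s) (fieldOp _ (h.isBddField_scalar_conj ℂ) f) := by
  refine ext_inner_right ℂ fun v => ?_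
  rw [adjoint_inner_left, adjoint_inner_left, adjoint_inner_left, hK, h.inner_scalar_conj]

theorem sum_cutoff_comp_eq_one (h : ∀ n : Option (Fin N), IsFluxCutoff α x n.toFinset (g n))
    (hg : ∀ y, ∑ n, g n y * starRingEnd ℂ (g n y) = 1)
    {K : ∀ n : Option (Fin N), FormSpace α x n.toFinset →L[ℂ] FormSpace α x Finset.univ}
    (hK : ∀ n v, formIncl α x _ (K n v) =
      fieldOp _ ((h n).isBddField_scalar ℂ) (formIncl α x n.toFinset v))
    {M : ∀ n : Option (Fin N), FormSpace α x Finset.univ →L[ℂ] FormSpace α x n.toFinset}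
    (hM : ∀ n v, formIncl α x _ (M n v) =
      fieldOp _ ((h n).isBddField_scalar_conj ℂ) (formIncl α x _ v)) :
    ∑ n, K n ∘L M n = 1 := by
  ext1 v
  refine formIncl_injective ?_
  rw [_root_.sum_apply, map_sum, one_apply_eq_self]
  simp only [ContinuousLinearMap.comp_apply, hK, hM]
  set f := formIncl α x Finset.univ v
  refine Lp.ext ((Lp.coeFn_finsetSum _ _).trans ?_)
  have h1 : ∀ n, (fieldOp _ ((h n).isBddField_scalar ℂ)
      (fieldOp _ ((h n).isBddField_scalar_conj ℂ) f) : E2 → ℂ) =ᵐ[volume]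
      fun y => g n y * starRingEnd ℂ (g n y) * f y := fun n => by
    filter_upwards [coeFn_fieldOp ((h n).isBddField_scalar ℂ)
      (fieldOp _ ((h n).isBddField_scalar_conj ℂ) f),
      coeFn_fieldOp ((h n).isBddField_scalar_conj ℂ) f] with y a b
    rw [a, b]
    simp [scalarField, mul_assoc]
  filter_upwards [ae_all_iff.2 h1] with y hy
  simp only [Finset.sum_apply, hy]
  rw [← Finset.sum_mul, hg, one_mul]

theorem commutatorSum_eq (h : ∀ n : Option (Fin N), IsFluxCutoff α x n.toFinset (g n)) (z : ℂ)
    {K : ∀ n : Option (Fin N), FormSpace α x n.toFinset →L[ℂ] FormSpace α x Finset.univ}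
    (hK : ∀ n v, formIncl α x _ (K n v) =
      fieldOp _ ((h n).isBddField_scalar ℂ) (formIncl α x n.toFinset v)) :
    commutatorSum h z = (∑ n, (h n).commutator ∘L
      Ring.inverse (shiftedForm (formIncl α x n.toFinset) z) ∘L adjoint (K n)) ∘L
      adjoint (formIncl α x Finset.univ) := by
  ext1 f
  rw [commutatorSum, ContinuousLinearMap.comp_apply, _root_.sum_apply, _root_.sum_apply]
  refine Finset.sum_congr rfl fun n _ => ?_
  rw [ContinuousLinearMap.comp_apply, ContinuousLinearMap.comp_apply,
    ContinuousLinearMap.comp_apply, ContinuousLinearMap.comp_apply, adjoint_cutoff (h n) (hK n)]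
  rfl

theorem sum_cutoff_solve_eq (h : ∀ n : Option (Fin N), IsFluxCutoff α x n.toFinset (g n)) (z : ℂ)
    {K : ∀ n : Option (Fin N), FormSpace α x n.toFinset →L[ℂ] FormSpace α x Finset.univ}
    (hK : ∀ n v, formIncl α x _ (K n v) =
      fieldOp _ ((h n).isBddField_scalar ℂ) (formIncl α x n.toFinset v)) (f : L2) :
    formIncl α x _ ((∑ n, K n ∘L Ring.inverse (shiftedForm (formIncl α x n.toFinset) z) ∘L
      adjoint (K n)) (adjoint (formIncl α x Finset.univ) f)) =
    ∑ n, fieldOp _ ((h n).isBddField_scalar ℂ) (formIncl α x _ (formSolve α x n.toFinset z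
        (fieldOp _ ((h n).isBddField_scalar_conj ℂ) f))) := by
  rw [_root_.sum_apply, map_sum]
  refine Finset.sum_congr rfl fun n _ => ?_
  rw [ContinuousLinearMap.comp_apply, ContinuousLinearMap.comp_apply, hK,
    adjoint_cutoff (h n) (hK n)]
  rfl

theorem isUnit_one_add_commutatorSum
    (h : ∀ n : Option (Fin N), IsFluxCutoff α x n.toFinset (g n))
    (hg : ∀ y, ∑ n, g n y * starRingEnd ℂ (g n y) = 1) {z : ℂ} (hz : z ∉ halfLine) :
    IsUnit (1 + commutatorSum h z) ∧ ∀ f,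
      formIncl α x _ (formSolve α x Finset.univ z ((1 + commutatorSum h z) f)) =
      ∑ n, fieldOp _ ((h n).isBddField_scalar ℂ) (formIncl α x _ (formSolve α x n.toFinset z
        (fieldOp _ ((h n).isBddField_scalar_conj ℂ) f))) := by
  obtain ⟨τ, hτ1, hτ2⟩ := exists_rotation_pos hz
  choose K hK using fun n => (h n).exists_map
  choose M hM using fun n => (h n).exists_map_conj
  have hK1 : ∀ n v, formIncl α x _ (K n v) =
      fieldOp _ ((h n).isBddField_scalar ℂ) (formIncl α x n.toFinset v) := fun n v => (hK n v).1
  have hKM := sum_cutoff_comp_eq_one h hg hK1 fun n v => (hM n v).1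
  have hcomm := fun n => (h n).comp_eq (z := z) (hK n) (hM n)
  obtain ⟨h1, h2⟩ := localization_formula (ι := Option (Fin N))
    (W := fun n => FormSpace α x n.toFinset) (A := shiftedForm (formIncl α x Finset.univ) z)
    (B := fun n => shiftedForm (formIncl α x n.toFinset) z)
    (p := fun n => (h n).commutator) (e := formIncl α x Finset.univ) (K := K) (M := M)
    (lt_min hτ1 hτ2) (re_mul_inner_shiftedForm_ge formSpace_inner)
    (fun n => re_mul_inner_shiftedForm_ge formSpace_inner) hKM hcomm
  rw [← commutatorSum_eq h z hK1] at h1 h2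
  refine ⟨h1, fun f => ?_⟩
  rw [← sum_cutoff_solve_eq h z hK1]
  exact congr(formIncl α x Finset.univ ($h2 f))

/-- Here `q` dominates the square root of the smallness parameter: the gradient of a local solution
is of size `q` and the solution of size `q²`, at most `q` because `q ≤ 1`. -/
theorem exists_norm_commutatorSum_le
    (h : ∀ n : Option (Fin N), IsFluxCutoff α x n.toFinset (g n)) :
    ∃ C, 0 ≤ C ∧ ∀ z : ℂ, z ∉ halfLine → ∀ q ≤ 1,
      1 / Metric.infDist z halfLine * (1 + ‖z‖ / Metric.infDist z halfLine) ≤ q ^ 2 → 0 ≤ q →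
      ‖commutatorSum h z‖ ≤ C * q := by
  refine ⟨∑ n, (2 * ‖fieldOp _ (h n).isBddField_dot‖ + ‖fieldOp _ (h n).isBddField_lap‖) *
    ‖fieldOp _ ((h n).isBddField_scalar_conj ℂ)‖, by positivity, fun z hz q hq1 hq hq0 => ?_⟩
  rw [Finset.sum_mul]
  refine (norm_sum_le _ _).trans (Finset.sum_le_sum fun n _ => ?_)
  refine ContinuousLinearMap.opNorm_le_bound _ (by positivity) fun f => ?_
  set k := fieldOp _ ((h n).isBddField_scalar_conj ℂ) f
  set u := formSolve α x n.toFinset z k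
  have hd := infDist_halfLine_pos hz
  have hk : ‖k‖ ≤ ‖fieldOp _ ((h n).isBddField_scalar_conj ℂ)‖ * ‖f‖ := le_opNorm _ _
  have hu1 : ‖formGradL α x _ u‖ ≤ q * ‖k‖ := by
    refine le_of_sq_le_sq ?_ (by positivity)
    rw [mul_pow]
    exact (norm_grad_shiftedFormSolve_sq_le formSpace_inner hz k).trans (by gcongr)
  have hu2 : ‖formIncl α x _ u‖ ≤ q * ‖k‖ := by
    have h1 : ‖formIncl α x _ u‖ ≤ ‖k‖ / Metric.infDist z halfLine := by
      rw [le_div_iff₀' hd]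
      exact norm_incl_shiftedFormSolve_le formSpace_inner hz k
    refine h1.trans ?_
    rw [div_eq_mul_inv, mul_comm, ← one_div]
    gcongr
    have h2 : 1 / Metric.infDist z halfLine ≤
        1 / Metric.infDist z halfLine * (1 + ‖z‖ / Metric.infDist z halfLine) :=
      le_mul_of_one_le_right (by positivity) (by
        have : 0 ≤ ‖z‖ / Metric.infDist z halfLine := by positivity
        linarith)
    nlinarith
  have hc : ‖(h n).commutator u‖ ≤ 2 * (‖fieldOp _ (h n).isBddField_dot‖ * ‖formGradL α x _ u‖) +
      ‖fieldOp _ (h n).isBddField_lap‖ * ‖formIncl α x _ u‖ := by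
    refine (norm_add_le _ _).trans (add_le_add ?_ (le_opNorm (fieldOp _ (h n).isBddField_lap) _))
    refine (norm_smul_le (2 : ℂ) (fieldOp _ (h n).isBddField_dot (formGradL α x _ u))).trans ?_
    rw [RCLike.norm_ofNat]
    gcongr
    exact le_opNorm (fieldOp _ (h n).isBddField_dot) _
  refine hc.trans ?_
  calc _ ≤ 2 * (‖fieldOp _ (h n).isBddField_dot‖ *
        (q * (‖fieldOp _ ((h n).isBddField_scalar_conj ℂ)‖ * ‖f‖))) +
      ‖fieldOp _ (h n).isBddField_lap‖ *
        (q * (‖fieldOp _ ((h n).isBddField_scalar_conj ℂ)‖ * ‖f‖)) := by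
        gcongr
        · exact hu1.trans (by gcongr)
        · exact hu2.trans (by gcongr)
    _ = _ := by ring

/-- The norm of the commutator sum tends to zero far away from the half-line. -/
theorem exists_norm_commutatorSum_lt_one
    (h : ∀ n : Option (Fin N), IsFluxCutoff α x n.toFinset (g n)) :
    ∃ δ : ℝ, 0 < δ ∧ ∀ z : ℂ, z ∉ halfLine →
      1 / Metric.infDist z halfLine * (1 + ‖z‖ / Metric.infDist z halfLine) ≤ δ →
      ‖commutatorSum h z‖ < 1 := by
  obtain ⟨C, hC, hCb⟩ := exists_norm_commutatorSum_le h
  -- Corresponds to `q = 1 / (C + 1)`, which gives both `q ≤ 1` and `C q < 1`.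
  refine ⟨(1 / (C + 1)) ^ 2, by positivity, fun z hz hq => ?_⟩
  refine (hCb z hz _ ?_ hq (by positivity)).trans_lt ?_
  · rw [div_le_one (by positivity)]
    linarith
  · rw [mul_one_div, div_lt_one (by positivity)]
    linarith

end Localization

theorem hasSum_neumann {R : Type*} [NormedRing R] [CompleteSpace R] [NormedAlgebra ℂ R] {t : R}
    (h : ‖t‖ < 1) : HasSum (fun j : ℕ => (-1 : ℂ) ^ j • t ^ j) (Ring.inverse (1 + t)) := by
  have h1 : ‖-t‖ < 1 := by rwa [norm_neg]
  have h2 : (fun j : ℕ => (-1 : ℂ) ^ j • t ^ j) = fun j => (-t) ^ j := by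
    ext j
    rw [← smul_pow, neg_smul, one_smul]
  rw [h2, ← sub_neg_eq_add, NormedRing.inverse_one_sub _ h1]
  exact (summable_geometric_of_norm_lt_one h1).hasSum

namespace IsFluxPartition

theorem sum_cutoff_mul_conj (hξ : IsFluxPartition x r ξ) (x₀ a₀ : E2) (y : E2) :
    ∑ n, ((phase α x x₀ a₀ n y)⁻¹ * (ξ n y : ℂ)) *
      starRingEnd ℂ ((phase α x x₀ a₀ n y)⁻¹ * (ξ n y : ℂ)) = 1 := by
  have h : ∀ n, ((phase α x x₀ a₀ n y)⁻¹ * (ξ n y : ℂ)) *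
      starRingEnd ℂ ((phase α x x₀ a₀ n y)⁻¹ * (ξ n y : ℂ)) = ((ξ n y ^ 2 : ℝ) : ℂ) := fun n => by
    rw [mul_conj, normSq_eq_norm_sq, norm_mul, norm_inv, norm_phase, inv_one, one_mul, norm_real,
      Real.norm_eq_abs, sq_abs]
  simp only [h]
  rw [← ofReal_sum, hξ.sum_sq, ofReal_one]

theorem conj_cutoff (x₀ a₀ : E2) (n : Option (Fin N)) :
    (fun y => starRingEnd ℂ ((phase α x x₀ a₀ n y)⁻¹ * (ξ n y : ℂ))) =
      fun y => (ξ n y : ℂ) * phase α x x₀ a₀ n y := by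
  ext y
  rw [map_mul, ← conj_phase, conj_conj, conj_ofReal, mul_comm]

theorem mulL2_conj_cutoff (hξ : IsFluxPartition x r ξ) (hr : 0 < r)
    (hx : ∀ m n, m ≠ n → r < dist (x m) (x n) / 2) (x₀ a₀ : E2) (n : Option (Fin N)) (f : L2) :
    mulL2 (fun y => (ξ n y : ℂ) * phase α x x₀ a₀ n y) f =
      fieldOp _ ((hξ.isFluxCutoff (α := α) hr hx x₀ a₀ n).isBddField_scalar_conj ℂ) f := by
  rw [← conj_cutoff]
  exact mulL2_eq_fieldOp _ f

/-- The abstract commutator is `e^{-iθ n} P n`. The default value of `singleGrad` plays no role,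
since its argument lies in the form domain. -/
theorem commutator_ae_eq (hξ : IsFluxPartition x r ξ) (hr : 0 < r)
    (hx : ∀ m n, m ≠ n → r < dist (x m) (x n) / 2) (x₀ a₀ : E2) (n : Option (Fin N))
    (u : FormSpace α x n.toFinset) :
    (hξ.isFluxCutoff (α := α) hr hx x₀ a₀ n).commutator u =ᵐ[volume] fun y =>
      (phase α x x₀ a₀ n y)⁻¹ * localOp α x a₀ ξ n (formIncl α x n.toFinset u) y := by
  set h := hξ.isFluxCutoff (α := α) hr hx x₀ a₀ n
  filter_upwards [Lp.coeFn_add ((2 : ℂ) • fieldOp _ h.isBddField_dot (formGradL α x _ u))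
      (fieldOp _ h.isBddField_lap (formIncl α x _ u)),
    Lp.coeFn_smul (2 : ℂ) (fieldOp _ h.isBddField_dot (formGradL α x _ u)),
    coeFn_fieldOp h.isBddField_dot (formGradL α x _ u),
    coeFn_fieldOp h.isBddField_lap (formIncl α x _ u)] with y a b c d
  refine a.trans ?_
  rw [Pi.add_apply, b, Pi.smul_apply, c, d, localOp, singleGrad_formIncl]
  have hl := hξ.magLaplacian_cutoff (α := α) hr hx (x₀ := x₀) (a₀ := a₀) n y
  have hg := hξ.magGrad_cutoff (α := α) (x₀ := x₀) (a₀ := a₀) n y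
  simp only [regPart] at hl hg
  simp only [dotField_apply, scalarField, _root_.smul_apply, hl, hg, Fin.sum_univ_two, smul_eq_mul,
    ContinuousLinearMap.id_apply]
  ring

end IsFluxPartition

end

end AharonovBohm

end

theorem mainTheorem8 {N : ℕ} (α : Fin N → ℝ) (hα : ∀ n, α n ∈ Set.Ioo (0 : ℝ) 1)
    (x : Fin N → AharonovBohm.E2) (r : ℝ) (hr : 0 < r)
    (hx : ∀ m n, m ≠ n → r < dist (x m) (x n) / 2)
    (ξ : Option (Fin N) → AharonovBohm.E2 → ℝ) (hξ : AharonovBohm.IsFluxPartition x r ξ)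
    (x₀ a₀ : AharonovBohm.E2) :
    (∀ z : ℂ, z ∉ AharonovBohm.halfLine →
      AharonovBohm.InResolventSet (AharonovBohm.friedrichs α x Finset.univ) z ∧
      ∀ n : Option (Fin N),
        AharonovBohm.InResolventSet (AharonovBohm.friedrichs α x n.toFinset) z) ∧
    ∃ T : ℂ → (AharonovBohm.L2 →L[ℂ] AharonovBohm.L2),
      (∀ z : ℂ, z ∉ AharonovBohm.halfLine →
        (∀ f : AharonovBohm.L2,
          T z f =ᵐ[MeasureTheory.volume] AharonovBohm.TFun α x x₀ a₀ ξ z f) ∧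
        IsUnit (1 + T z) ∧
        ∀ f : AharonovBohm.L2,
          AharonovBohm.resolventOp (AharonovBohm.friedrichs α x Finset.univ) z f =
            AharonovBohm.localizedSum α x x₀ a₀ ξ z (Ring.inverse (1 + T z) f)) ∧
      ∃ δ : ℝ, 0 < δ ∧ ∀ z : ℂ, z ∉ AharonovBohm.halfLine →
        1 / Metric.infDist z AharonovBohm.halfLine *
            (1 + ‖z‖ / Metric.infDist z AharonovBohm.halfLine) ≤ δ →
        ‖T z‖ < 1 ∧ HasSum (fun j : ℕ => (-1 : ℂ) ^ j • T z ^ j) (Ring.inverse (1 + T z)) := by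
  have hcut := hξ.isFluxCutoff (α := α) hr hx x₀ a₀
  have hone := hξ.sum_cutoff_mul_conj (α := α) x₀ a₀
  refine ⟨fun z hz => ⟨⟨_, AharonovBohm.isResolvent_friedrichs hz⟩,
    fun n => ⟨_, AharonovBohm.isResolvent_friedrichs hz⟩⟩,
    AharonovBohm.commutatorSum hcut, fun z hz => ⟨fun f => ?_, ?_, fun f => ?_⟩, ?_⟩
  · have h1 : AharonovBohm.commutatorSum hcut z f = ∑ n, (hcut n).commutator
        (AharonovBohm.formSolve α x n.toFinset z
          (AharonovBohm.fieldOp _ ((hcut n).isBddField_scalar_conj ℂ) f)) := by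
      rw [AharonovBohm.commutatorSum, sum_apply]
      rfl
    rw [h1]
    refine (MeasureTheory.Lp.coeFn_finsetSum _ _).trans ?_
    filter_upwards [MeasureTheory.ae_all_iff.2 fun n => hξ.commutator_ae_eq (α := α) hr hx x₀ a₀ n
      (AharonovBohm.formSolve α x n.toFinset z
        (AharonovBohm.fieldOp _ ((hcut n).isBddField_scalar_conj ℂ) f))] with y hy
    rw [Finset.sum_apply, AharonovBohm.TFun]
    refine Finset.sum_congr rfl fun n _ => (hy n).trans ?_
    rw [AharonovBohm.singleResolvent, AharonovBohm.resolventOp_friedrichs hz,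
      hξ.mulL2_conj_cutoff hr hx]
    rfl
  · exact (AharonovBohm.isUnit_one_add_commutatorSum hcut hone hz).1
  · obtain ⟨hu, hf⟩ := AharonovBohm.isUnit_one_add_commutatorSum hcut hone hz
    -- The identity is available as a formula for `R (1 + T)`, so it is evaluated at `(1 + T)⁻¹ f`.
    set F := Ring.inverse (1 + AharonovBohm.commutatorSum hcut z) f
    have hF : (1 + AharonovBohm.commutatorSum hcut z) F = f :=
      congr($(Ring.mul_inverse_cancel _ hu) f)
    have h1 := hf F
    rw [hF] at h1
    rw [AharonovBohm.resolventOp_friedrichs hz, AharonovBohm.localizedSum]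
    refine h1.trans (Finset.sum_congr rfl fun n _ => ?_)
    rw [AharonovBohm.singleResolvent, AharonovBohm.resolventOp_friedrichs hz,
      hξ.mulL2_conj_cutoff hr hx]
    exact (AharonovBohm.mulL2_eq_fieldOp _ _).symm
  · obtain ⟨δ, hδ, h⟩ := AharonovBohm.exists_norm_commutatorSum_lt_one hcut
    exact ⟨δ, hδ, fun z hz hq => ⟨h z hz hq, AharonovBohm.hasSum_neumann (h z hz hq)⟩⟩
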